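/- Conventions. Let $\mathcal A=\{0,\frac\pi8,\frac\pi4,\frac\pi2,\frac{5\pi}8,\frac{3\pi}4\}$, and for $a\in\mathbb R$ let $|a\rangle=\cos a\,|0\rangle+\sin a\,|1\rangle\in\mathbb C^2$; for a tuple $a=(a^i)_i$ put $|a\rangle=\bigotimes_i|a^i\rangle$. Let $A=\bigotimes_{i=1}^nA^i$ and $B=\bigotimes_{i=1}^nB^i$ be tensor products of Hilbert spaces, and for every $i$ let $(P_{A^i}^{a},P_{A^i}^{a+\pi/2})$ and $(P_{B^i}^{a},P_{B^i}^{a+\pi/2})$, $a\in\{0,\frac\pi8,\frac\pi4\}$, be orthogonal measurements on $A^i$ and $B^i$ (pairs of orthogonal projectors summing to the identity). For $I\subseteq\{1,\dots,n\}$ and $a\in\mathcal A^I$ let $P_{A^I}^a=\bigotimes_{i\in I}P_{A^i}^{a^i}$ (extended by the identity), $P_A^a=P_{A^{\{1,\dots,n\}}}^a$, and similarly for $B$. For $x\in\{0,1\}^n$, $P_B^x$ denotes $P_B^{b}$ with $b^i=x_i\frac\pi2$. Let $|\phi^+\rangle=\frac1{\sqrt2}(|00\rangle+|11\rangle)$ and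 $|\Phi^+\rangle_I=2^{-|I|/2}\sum_{z\in\{0,1\}^I}|z\rangle\otimes|z\rangle$. A vector $\psi$ *simulates* a state $|\phi\rangle$ of qubits with respect to projectors $(P^w)_w$, labelled by ideal states $|w\rangle$, if $\|P^w\psi\|^2=|\langle w|\phi\rangle|^2$ for all $w$; a mixed state with density operator $\rho$ simulates $|\phi\rangle$ if $\operatorname{tr}(P^w\rho)=|\langle w|\phi\rangle|^2$ for all $w$. Hypotheses. Let $k\in\mathbb N$, let $I^1,\dots,I^t\subseteq\{1,\dots,n\}$ with $|I^j|\le k$, let $G_A^j\in\mathcal U(A^{I^j})$, $G_B^j\in\mathcal U(B^{I^j})$ (where $A^{I}=\bigotimes_{i\in I}A^i$, $B^I=\bigotimes_{i\in I}B^i$), and let $T^j$ be a real orthogonal gate on the qubits in $I^j$. Let $G_A=G_A^t\cdots G_A^1\in\mathcal U(A)$ and let $T=T^t\cdots T^1$, a unitary on $n$ qubits. Let $\Psi\in A\otimes B$ be a unit vector and put $\Psi^0=\Psi$, $\Psi^j=(G_A^j\otimes G_B^j)\Psi^{j-1}$, $\Psi'^j=(G_A^j\otimes\mathrm{Id}_B)\Psi^{j-1}$.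 Consider the conditions: 1. for every $i\in\{1,\dots,n\}$, $\Psi$ simulates $|\phi^+\rangle$ with respect to $(P_{A^i}^{a}\otimes P_{B^i}^{b})_{a,b\in\mathcal A}$; 2. for every $j$ and every $i\in I^j$, $\Psi^j$ simulates $|\phi^+\rangle$ with respect to $(P_{A^i}^{a}\otimes P_{B^i}^{b})_{a,b\in\mathcal A}$; 3. for every $j$, $\Psi'^j$ simulates $(T^j\otimes\mathrm{Id})|\Phi^+\rangle_{I^j}$ with respect to $(P_{A^{I^j}}^{a}\otimes P_{B^{I^j}}^{b})_{a,b\in\mathcal A^{I^j}}$. Conclusions. Assume 1–3. For $x\in\{0,1\}^n$ let $\rho_x=2^n\operatorname{tr}_B\big(P_B^x|\Psi\rangle\langle\Psi|P_B^x\big)$ be the state of $A$ denoted $\sqrt{2^n}\operatorname{tr}_B(P_B^x\Psi)$. Then: (a) for every $x\in\{0,1\}^n$, $\rho_x$ simulates $|x\rangle$ with respect to $(P_A^w)_{w\in\mathcal A^n}$; (b) $G_A$ simulates $T$ under this identification: for every $x\in\{0,1\}^n$, $G_A\rho_xG_A^\dagger$ simulates $T|x\rangle$ with respect to $(P_A^w)_{w\in\mathcal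 A^n}$. (c) Moreover, conditions 1–3 say exactly that each member of a finite list of outcome probabilities (one for each projector in 1–3, for each $i$, each $(j,i)$ and each $j$, respectively) has its ideal value. There is a constant $C$, depending only on $k$, such that this list has at most $C(n+t)$ members, and at most $Ct$ members if every $i\in\{1,\dots,n\}$ lies in some $I^j$. -/

import Mathlib

open scoped Kronecker InnerProductSpace

noncomputable section

namespace SelfTest

/-! ### Hilbert spaces and tensor products

A register is a Hilbert space `ℓ²(X)` with `X` an arbitrary index type; up to a choice of an
orthonormal basis this is an arbitrary Hilbert space (of any dimension). The Hilbert space tensor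
product of `ℓ²(X)` and `ℓ²(Y)` is `ℓ²(X × Y)`, and that of a finite family `ℓ²(α i)` is
`ℓ²(∀ i, α i)`. -/

/-- The Hilbert space with orthonormal basis indexed by `X`. -/
abbrev L2 (X : Type*) : Type _ := lp (fun _ : X => ℂ) 2

/-- Bounded operators on `ℓ²(X)`. -/
abbrev Op (X : Type*) : Type _ := L2 X →L[ℂ] L2 X

theorem memL2_iff {X : Type*} (f : X → ℂ) :
    Memℓp f 2 ↔ Summable fun x => ‖f x‖ ^ 2 := by
  rw [memℓp_gen_iff (by norm_num)]
  simp

theorem hasSum_norm_sq {X : Type*} (f : L2 X) : HasSum (fun x => ‖f x‖ ^ 2) (‖f‖ ^ 2) := by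
  have h := lp.hasSum_norm (p := 2) (by norm_num) f
  simpa using h

/-- The slice `y ↦ f (y, z)` of `f`, under the identification `e : X ≃ Y × Z`. -/
def slice {X Y Z : Type*} (e : X ≃ Y × Z) (f : L2 X) (z : Z) : L2 Y :=
  ⟨fun y => f (e.symm (y, z)), by
    refine (memL2_iff _).2 ?_
    have h := (hasSum_norm_sq f).summable
    exact h.comp_injective (i := fun y => e.symm (y, z)) (fun a b hab => by
      simpa using e.symm.injective hab)⟩

@[simp] theorem slice_apply {X Y Z : Type*} (e : X ≃ Y × Z) (f : L2 X) (z : Z) (y : Y) :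
    slice e f z y = f (e.symm (y, z)) := rfl

theorem slice_add {X Y Z : Type*} (e : X ≃ Y × Z) (f g : L2 X) (z : Z) :
    slice e (f + g) z = slice e f z + slice e g z := by
  ext y; simp

theorem slice_smul {X Y Z : Type*} (e : X ≃ Y × Z) (c : ℂ) (f : L2 X) (z : Z) :
    slice e (c • f) z = c • slice e f z := by
  ext y; simp

theorem hasSum_slice {X Y Z : Type*} (e : X ≃ Y × Z) (f : L2 X) :
    HasSum (fun z => ‖slice e f z‖ ^ 2) (‖f‖ ^ 2) := by
  have h := hasSum_norm_sq f
  have h1 : HasSum (fun p : Z × Y => ‖f (e.symm (p.2, p.1))‖ ^ 2) (‖f‖ ^ 2) :=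
    (((Equiv.prodComm Z Y).trans e.symm).hasSum_iff (f := fun x => ‖f x‖ ^ 2)).2 h
  exact h1.prod_fiberwise fun z => hasSum_norm_sq (slice e f z)

theorem summable_amp {X Y Z : Type*} (e : X ≃ Y × Z) (M : Op Y) (f : L2 X) :
    Summable (fun x => ‖M (slice e f (e x).2) (e x).1‖ ^ 2) ∧
      ∑' x, ‖M (slice e f (e x).2) (e x).1‖ ^ 2 ≤ (‖M‖ * ‖f‖) ^ 2 := by
  have hle : ∀ z, ‖M (slice e f z)‖ ^ 2 ≤ ‖M‖ ^ 2 * ‖slice e f z‖ ^ 2 := fun z => by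
    rw [← mul_pow]
    exact pow_le_pow_left₀ (norm_nonneg _) (M.le_opNorm _) 2
  have hs := (hasSum_slice e f).mul_left (‖M‖ ^ 2)
  have hS : Summable fun z => ‖M (slice e f z)‖ ^ 2 :=
    Summable.of_nonneg_of_le (fun z => by positivity) hle hs.summable
  have hP : Summable (fun p : Z × Y => ‖M (slice e f p.1) p.2‖ ^ 2) := by
    refine (summable_prod_of_nonneg (fun _ => by positivity)).2 ⟨fun z => ?_, ?_⟩
    · exact (hasSum_norm_sq (M (slice e f z))).summable
    · exact hS.congr fun z => ((hasSum_norm_sq (M (slice e f z))).tsum_eq).symm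
  have hH : HasSum (fun p : Z × Y => ‖M (slice e f p.1) p.2‖ ^ 2)
      (∑' z, ‖M (slice e f z)‖ ^ 2) := by
    have h2 := hP.hasSum.prod_fiberwise fun z => hasSum_norm_sq (M (slice e f z))
    rw [h2.tsum_eq]
    exact hP.hasSum
  have hX : HasSum (fun x => ‖M (slice e f (e x).2) (e x).1‖ ^ 2)
      (∑' z, ‖M (slice e f z)‖ ^ 2) :=
    ((e.trans (Equiv.prodComm Y Z)).hasSum_iff
      (f := fun p : Z × Y => ‖M (slice e f p.1) p.2‖ ^ 2)).2 hH
  refine ⟨hX.summable, ?_⟩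
  rw [hX.tsum_eq, mul_pow, ← hs.tsum_eq]
  exact hS.tsum_le_tsum hle hs.summable

/-- The operator `M ⊗ Id` on `ℓ²(X)`, where `X ≃ Y × Z` identifies `ℓ²(X)` with
`ℓ²(Y) ⊗ ℓ²(Z)`, and `M` acts on `ℓ²(Y)`. -/
def amp {X Y Z : Type*} (e : X ≃ Y × Z) (M : Op Y) : Op X :=
  LinearMap.mkContinuous
    { toFun := fun f => ⟨fun x => M (slice e f (e x).2) (e x).1,
        (memL2_iff _).2 (summable_amp e M f).1⟩
      map_add' := fun f g => by
        ext x
        simp only [slice_add, map_add]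
        rfl
      map_smul' := fun c f => by ext x; simp [slice_smul] }
    ‖M‖ (fun f => by
      refine le_of_sq_le_sq ?_ (by positivity)
      rw [← (hasSum_norm_sq _).tsum_eq]
      exact (summable_amp e M f).2)

@[simp] theorem amp_apply {X Y Z : Type*} (e : X ≃ Y × Z) (M : Op Y) (f : L2 X) (x : X) :
    amp e M f x = M (slice e f (e x).2) (e x).1 := rfl

/-- On elementary tensors, `(M ⊗ Id) (u ⊗ v) = (M u) ⊗ v`. -/
theorem amp_product {X Y Z : Type*} (e : X ≃ Y × Z) (M : Op Y) (f : L2 X) (u : L2 Y) (v : L2 Z)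
    (hf : ∀ x, f x = u (e x).1 * v (e x).2) (x : X) :
    amp e M f x = M u (e x).1 * v (e x).2 := by
  have h : slice e f (e x).2 = v (e x).2 • u := by
    ext y; simp [hf, mul_comm]
  simp [h, mul_comm]

/-- For `ξ ∈ ℓ²(X) ⊗ ℓ²(Y)`, the operator `f ↦ (y ↦ ⟪ξ(·, y), f⟫)` from `ℓ²(X)` to `ℓ²(Y)`. -/
def contract {X Y : Type*} (ξ : L2 (X × Y)) : L2 X →L[ℂ] L2 Y :=
  have key : ∀ f : L2 X, Summable (fun y => ‖⟪slice (Equiv.refl _) ξ y, f⟫_ℂ‖ ^ 2) ∧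
      ∑' y, ‖⟪slice (Equiv.refl _) ξ y, f⟫_ℂ‖ ^ 2 ≤ (‖ξ‖ * ‖f‖) ^ 2 := fun f => by
    have hle : ∀ y, ‖⟪slice (Equiv.refl (X × Y)) ξ y, f⟫_ℂ‖ ^ 2 ≤
        ‖slice (Equiv.refl _) ξ y‖ ^ 2 * ‖f‖ ^ 2 := fun y => by
      rw [← mul_pow]
      exact pow_le_pow_left₀ (norm_nonneg _) (norm_inner_le_norm _ _) 2
    have hs := (hasSum_slice (Equiv.refl _) ξ).mul_right (‖f‖ ^ 2)
    have hS := Summable.of_nonneg_of_le (fun y => by positivity) hle hs.summable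
    refine ⟨hS, ?_⟩
    rw [mul_pow, ← hs.tsum_eq]
    exact hS.tsum_le_tsum hle hs.summable
  LinearMap.mkContinuous
    { toFun := fun f => ⟨fun y => ⟪slice (Equiv.refl _) ξ y, f⟫_ℂ, (memL2_iff _).2 (key f).1⟩
      map_add' := fun f g => by
        ext y
        simp only [inner_add_right]
        rfl
      map_smul' := fun c f => by ext y; simp }
    ‖ξ‖ (fun f => by
      refine le_of_sq_le_sq ?_ (by positivity)
      rw [← (hasSum_norm_sq _).tsum_eq]
      exact (key f).2)

@[simp] theorem contract_apply {X Y : Type*} (ξ : L2 (X × Y)) (f : L2 X) (y : Y) :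
    contract ξ f y = ⟪slice (Equiv.refl _) ξ y, f⟫_ℂ := rfl

/-- The reduced density operator `tr_B |ξ⟩⟨ξ|` on `A = ℓ²(X)` of a vector `ξ ∈ A ⊗ B`,
`B = ℓ²(Y)`; that is, `∑_y |ξ(·, y)⟩⟨ξ(·, y)|`. -/
def reducedState {X Y : Type*} (ξ : L2 (X × Y)) : Op X :=
  (ContinuousLinearMap.adjoint (contract ξ)).comp (contract ξ)

theorem hasSum_reducedState {X Y : Type*} (ξ : L2 (X × Y)) (f g : L2 X) :
    HasSum (fun y => ⟪f, slice (Equiv.refl _) ξ y⟫_ℂ * ⟪slice (Equiv.refl _) ξ y, g⟫_ℂ)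
      ⟪f, reducedState ξ g⟫_ℂ := by
  have h := lp.hasSum_inner (𝕜 := ℂ) (contract ξ f) (contract ξ g)
  have h2 : ⟪f, reducedState ξ g⟫_ℂ = ⟪contract ξ f, contract ξ g⟫_ℂ := by
    simp [reducedState, ContinuousLinearMap.adjoint_inner_right]
  rw [h2]
  refine h.congr_fun ?_
  intro y
  simp [mul_comm]

open Classical in
/-- `M` has trace `c`: the diagonal of `M` in the orthonormal basis is summable with sum `c`. -/
def HasTrace {X : Type*} (M : Op X) (c : ℂ) : Prop :=
  HasSum (fun x => ⟪(lp.single 2 x (1 : ℂ) : L2 X), M (lp.single 2 x (1 : ℂ))⟫_ℂ) c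

/-! ### Registers made of several subregisters -/

variable {n : ℕ}

/-- An operator on `⨂_{i ∈ I} A^i`, extended by the identity to `A = ⨂_i A^i`. -/
def onSubset {α : Fin n → Type*} (I : Finset (Fin n)) (M : Op (∀ i : {i // i ∈ I}, α i)) :
    Op (∀ i, α i) :=
  amp (Equiv.piEquivPiSubtypeProd (fun i => i ∈ I) α) M

/-- An operator on the single register `A^i`, extended by the identity to `A = ⨂_i A^i`. -/
def onReg {α : Fin n → Type*} (i : Fin n) (M : Op (α i)) : Op (∀ i, α i) :=
  amp (Equiv.piSplitAt i α) M

/-- The tensor product `⨂_i M_i`, as the product of the (commuting) operators `M_i` on `A`. -/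
def tensorOp {α : Fin n → Type*} (M : ∀ i, Op (α i)) : Op (∀ i, α i) :=
  (List.ofFn fun i => onReg i (M i)).prod

/-- `M ⊗ Id_B` on `A ⊗ B`. -/
def onA {X Y : Type*} (M : Op X) : Op (X × Y) := amp (Equiv.refl _) M

/-- `Id_A ⊗ M` on `A ⊗ B`. -/
def onB {X Y : Type*} (M : Op Y) : Op (X × Y) := amp (Equiv.prodComm X Y) M

/-! ### Measurement angles, orthogonal measurements, ideal states -/

/-- Labels of the six angles `0, π/8, π/4, π/2, 5π/8, 3π/4`. -/
abbrev Angle : Type := Fin 3 × Fin 2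

/-- The angle with label `(k, s)` is `k π/8 + s π/2`. -/
def Angle.val (a : Angle) : ℝ := (a.1 : ℕ) * (Real.pi / 8) + (a.2 : ℕ) * (Real.pi / 2)

/-- The label of the computational basis state `|s⟩`: the angle `0` or `π/2`. -/
def bitAngle (s : Fin 2) : Angle := (0, s)

/-- A family of orthogonal measurements `(P^a, P^{a + π/2})`, `a ∈ {0, π/8, π/4}`. -/
structure Measurements (X : Type*) where
  proj : Angle → Op X
  isStarProjection : ∀ a, IsStarProjection (proj a)
  add_eq_one : ∀ k, proj (k, 0) + proj (k, 1) = 1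

/-- The projector `P_{A^I}^a = ⨂_{i ∈ I} P_{A^i}^{a^i}`, extended by the identity to `A`. -/
def projOn {α : Fin n → Type*} (P : ∀ i, Measurements (α i)) (I : Finset (Fin n))
    (a : {i // i ∈ I} → Angle) : Op (∀ i, α i) :=
  tensorOp fun i => if h : i ∈ I then (P i).proj (a ⟨i, h⟩) else 1

/-- The projector `P_A^a = ⨂_i P_{A^i}^{a^i}`. -/
def projAll {α : Fin n → Type*} (P : ∀ i, Measurements (α i)) (a : Fin n → Angle) :
    Op (∀ i, α i) :=
  tensorOp fun i => (P i).proj (a i)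

/-- The qubit state `|a⟩ = cos a |0⟩ + sin a |1⟩`. -/
def ket (a : Angle) : EuclideanSpace ℂ (Fin 2) :=
  !₂[(Real.cos a.val : ℂ), (Real.sin a.val : ℂ)]

/-- The product state `⨂_i |a^i⟩`; the computational basis is indexed by bit strings. -/
def kets {κ : Type*} [Fintype κ] (a : κ → Angle) : EuclideanSpace ℂ (κ → Fin 2) :=
  WithLp.toLp 2 fun x => ∏ i, ket (a i) (x i)

/-- The product state `|u⟩ ⊗ |v⟩`. -/
def tensorKet {κ μ : Type*} (u : EuclideanSpace ℂ κ) (v : EuclideanSpace ℂ μ) :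
    EuclideanSpace ℂ (κ × μ) :=
  WithLp.toLp 2 fun p => u p.1 * v p.2

open Classical in
/-- The maximally entangled state `|κ|^{-1/2} ∑_x |x⟩ ⊗ |x⟩`. For `κ = Fin 2` this is the EPR state
`|φ⁺⟩`, and for `κ = (I → Fin 2)` it is the state `|Φ⁺⟩_I` of `|I|` EPR pairs. -/
def maxEntangled (κ : Type*) [Fintype κ] : EuclideanSpace ℂ (κ × κ) :=
  WithLp.toLp 2 fun p => if p.1 = p.2 then (((√(Fintype.card κ : ℝ))⁻¹ : ℝ) : ℂ) else 0

/-- A matrix applied to a vector of `ℂ^κ`. -/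
def applyMat {κ : Type*} [Fintype κ] (T : Matrix κ κ ℂ) (v : EuclideanSpace ℂ κ) :
    EuclideanSpace ℂ κ :=
  WithLp.toLp 2 (T.mulVec v.ofLp)

/-! ### Simulation -/

/-- `ψ` simulates `φ` with respect to the projectors `P^w`, which are labelled by the ideal states
`|w⟩ = ideal w`. -/
def Simulates {X W κ : Type*} [Fintype κ] (P : W → Op X) (ideal : W → EuclideanSpace ℂ κ)
    (ψ : L2 X) (φ : EuclideanSpace ℂ κ) : Prop :=
  ∀ w, ‖P w ψ‖ ^ 2 = ‖⟪ideal w, φ⟫_ℂ‖ ^ 2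

/-- Simulation of `φ` by a mixed state, given by its density operator `ρ`: the outcome `w` has
probability `tr (P^w ρ)`. -/
def MixedSimulates {X W κ : Type*} [Fintype κ] (P : W → Op X) (ideal : W → EuclideanSpace ℂ κ)
    (ρ : Op X) (φ : EuclideanSpace ℂ κ) : Prop :=
  ∀ w, HasTrace (P w * ρ) ((‖⟪ideal w, φ⟫_ℂ‖ ^ 2 : ℝ) : ℂ)

open Classical in
/-- The unitary `G` simulates the unitary `T` when the computational basis states `|x⟩` are
simulated by the (mixed) states `ρ x`: every `G ρ_x G†` simulates `T |x⟩`. -/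
def GateSimulates {X W κ : Type*} [Fintype κ] (P : W → Op X) (ideal : W → EuclideanSpace ℂ κ)
    (ρ : κ → Op X) (G : Op X) (T : Matrix κ κ ℂ) : Prop :=
  (∀ x, MixedSimulates P ideal (ρ x) (EuclideanSpace.single x 1)) ∧
    ∀ x, MixedSimulates P ideal (G * ρ x * star G) (applyMat T (EuclideanSpace.single x 1))

/-! ### Circuits -/

/-- A physical gate pair `G_A ∈ U(A^I)`, `G_B ∈ U(B^I)` and an ideal real gate `T ∈ O(A_c^I)`
on the qubits in `I`. -/
structure Gate (α : Fin n → Type*) (β : Fin n → Type*) where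
  support : Finset (Fin n)
  opA : unitary (Op (∀ i : {i // i ∈ support}, α i))
  opB : unitary (Op (∀ i : {i // i ∈ support}, β i))
  ideal : Matrix.orthogonalGroup ({i // i ∈ support} → Fin 2) ℝ

namespace Gate

variable {α : Fin n → Type*} {β : Fin n → Type*}

/-- `G_A`, extended by the identity to `A`. -/
def extA (g : Gate α β) : Op (∀ i, α i) := onSubset g.support (g.opA : Op _)

/-- `G_B`, extended by the identity to `B`. -/
def extB (g : Gate α β) : Op (∀ i, β i) := onSubset g.support (g.opB : Op _)

/-- `T` as a complex matrix on the qubits of its support. -/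
def idealC (g : Gate α β) :
    Matrix ({i // i ∈ g.support} → Fin 2) ({i // i ∈ g.support} → Fin 2) ℂ :=
  (g.ideal : Matrix _ _ ℝ).map Complex.ofReal

open Classical in
/-- `T`, extended by the identity to all `n` qubits. -/
def extIdeal (g : Gate α β) : Matrix (Fin n → Fin 2) (Fin n → Fin 2) ℂ :=
  Matrix.of fun x y =>
    if ∀ i, i ∉ g.support → x i = y i then g.idealC (fun i => x i) (fun i => y i) else 0

/-- `(T ⊗ Id) |Φ⁺⟩_I`. -/
def idealOutput (g : Gate α β) :
    EuclideanSpace ℂ (({i // i ∈ g.support} → Fin 2) × ({i // i ∈ g.support} → Fin 2)) :=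
  applyMat (g.idealC ⊗ₖ (1 : Matrix ({i // i ∈ g.support} → Fin 2) _ ℂ))
    (maxEntangled ({i // i ∈ g.support} → Fin 2))

end Gate

/-- The composition `g_t ⋯ g_2 g_1`. -/
def compose {M : Type*} [Monoid M] {t : ℕ} (g : Fin t → M) : M := (List.ofFn g).reverse.prod

section circuit

variable {t : ℕ} {α : Fin n → Type*} {β : Fin n → Type*}

/-- `Ψ^0 = Ψ` and `Ψ^j = (G_A^j ⊗ G_B^j) Ψ^{j-1}`. -/
def stateAt (g : Fin t → Gate α β) (Ψ : L2 ((∀ i, α i) × (∀ i, β i))) :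
    Fin (t + 1) → L2 ((∀ i, α i) × (∀ i, β i)) :=
  Fin.induction Ψ fun j ψ => onA (g j).extA (onB (g j).extB ψ)

/-- `Ψ'^j = (G_A^j ⊗ Id_B) Ψ^{j-1}`; the index `j : Fin t` stands for the `(j+1)`-st gate. -/
def halfStateAt (g : Fin t → Gate α β) (Ψ : L2 ((∀ i, α i) × (∀ i, β i))) (j : Fin t) :
    L2 ((∀ i, α i) × (∀ i, β i)) :=
  onA (g j).extA (stateAt g Ψ j.castSucc)

/-- `P_{A^i}^a ⊗ P_{B^i}^b` on `A ⊗ B`. -/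
def pairProj (PA : ∀ i, Measurements (α i)) (PB : ∀ i, Measurements (β i)) (i : Fin n)
    (ab : Angle × Angle) : Op ((∀ i, α i) × (∀ i, β i)) :=
  onA (onReg i ((PA i).proj ab.1)) * onB (onReg i ((PB i).proj ab.2))

/-- `P_{A^I}^a ⊗ P_{B^I}^b` on `A ⊗ B`. -/
def subsetProj (PA : ∀ i, Measurements (α i)) (PB : ∀ i, Measurements (β i))
    (I : Finset (Fin n)) (ab : ({i // i ∈ I} → Angle) × ({i // i ∈ I} → Angle)) :
    Op ((∀ i, α i) × (∀ i, β i)) :=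
  onA (projOn PA I ab.1) * onB (projOn PB I ab.2)

/-- The simulation conditions on a source `Ψ` and a sequence of gates. -/
structure SimulationConditions (PA : ∀ i, Measurements (α i)) (PB : ∀ i, Measurements (β i))
    (g : Fin t → Gate α β) (Ψ : L2 ((∀ i, α i) × (∀ i, β i))) : Prop where
  /-- `Ψ` simulates an EPR state on each pair of registers. -/
  source : ∀ i, Simulates (pairProj PA PB i) (fun ab => tensorKet (ket ab.1) (ket ab.2))
    Ψ (maxEntangled (Fin 2))
  /-- `Ψ^j` simulates an EPR state on each pair of registers in `I^j`. -/
  conspiracy : ∀ j, ∀ i ∈ (g j).support,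
    Simulates (pairProj PA PB i) (fun ab => tensorKet (ket ab.1) (ket ab.2))
      (stateAt g Ψ j.succ) (maxEntangled (Fin 2))
  /-- `Ψ'^j` simulates `T^j |Φ⁺⟩` on the registers in `I^j`. -/
  tomography : ∀ j, Simulates (subsetProj PA PB (g j).support)
    (fun ab => tensorKet (kets ab.1) (kets ab.2)) (halfStateAt g Ψ j) (g j).idealOutput

/-- The individual statistics (one experiment and one joint outcome each), for gates with supports
`I j`: those of the source, those of the states `Ψ^j`, and those of the states `Ψ'^j`. -/
abbrev Statistic (I : Fin t → Finset (Fin n)) : Type :=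
  (Fin n × (Angle × Angle)) ⊕
    (Σ j : Fin t, {i // i ∈ I j} × (Angle × Angle)) ⊕
    (Σ j : Fin t, ({i // i ∈ I j} → Angle) × ({i // i ∈ I j} → Angle))

/-- The probability of the outcome in the physical experiment. -/
def observed (PA : ∀ i, Measurements (α i)) (PB : ∀ i, Measurements (β i))
    (g : Fin t → Gate α β) (Ψ : L2 ((∀ i, α i) × (∀ i, β i))) :
    Statistic (fun j => (g j).support) → ℝ
  | .inl (i, ab) => ‖pairProj PA PB i ab Ψ‖ ^ 2
  | .inr (.inl ⟨j, i, ab⟩) => ‖pairProj PA PB i ab (stateAt g Ψ j.succ)‖ ^ 2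
  | .inr (.inr ⟨j, ab⟩) => ‖subsetProj PA PB (g j).support ab (halfStateAt g Ψ j)‖ ^ 2

/-- The probability of the outcome in the ideal experiment. -/
def expected (g : Fin t → Gate α β) : Statistic (fun j => (g j).support) → ℝ
  | .inl (_, ab) => ‖⟪tensorKet (ket ab.1) (ket ab.2), maxEntangled (Fin 2)⟫_ℂ‖ ^ 2
  | .inr (.inl ⟨_, _, ab⟩) => ‖⟪tensorKet (ket ab.1) (ket ab.2), maxEntangled (Fin 2)⟫_ℂ‖ ^ 2
  | .inr (.inr ⟨j, ab⟩) => ‖⟪tensorKet (kets ab.1) (kets ab.2), (g j).idealOutput⟫_ℂ‖ ^ 2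

/-- The density operator of the state `√(2^n) tr_B (P_B^x |Ψ⟩)` of `A`. -/
def inputState (PB : ∀ i, Measurements (β i)) (Ψ : L2 ((∀ i, α i) × (∀ i, β i)))
    (x : Fin n → Fin 2) : Op (∀ i, α i) :=
  reducedState (((√((2 : ℝ) ^ n) : ℝ) : ℂ) • onB (projAll PB fun i => bitAngle (x i)) Ψ)

end circuit

end SelfTest

end

noncomputable section

namespace SelfTest

/-! ### Ordered products of commuting families -/

section OrderedProducts

variable {R : Type*} [Monoid R] {n : ℕ}

/-! EPR correlations are rigid. Orthogonal angles never occur together, so P_A^a Ψ = P_B^a Ψ, and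
all inner products between the vectors P_A^a Ψ are then prescribed. Write Z, D, X for the ±1
observables at 0, π/8, π/4. The inner products force √2 D Ψ = (Z + X) Ψ, and squaring this with the
help of the commuting copies on B gives XZ Ψ = -ZX Ψ (`IsEPR.diagonal`, `IsEPR.anticommute`).
Operators on B commute with these relations, which therefore hold on the whole subspace of vectors M
Ψ with M on B (`IsEPR.isQubit`). On it every register behaves like a qubit tensored with an unknown
space. No tensor factor is split off: `raise` and `lower` create and erase basis states, and a
vector fixed by all projectors at angle 0 (`IsGround`) stands for |0…0⟩ ⊗ junk.

Real product measurements suffice for tomography of a real state. If a vector-valued tensor q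
satisfies ‖q(a)‖² = p(a)² at the tested angles, polarisation extends this to all real product
vectors (`sq_norm_multilinear_of_angles`). Hence q vanishes wherever p does, and this makes q equal
to p times one fixed vector (`multilinear_proportional`). So the amplitudes of (G_A ⊗ Id) Ψ are the
entries T_xy times a single vector χ. On Ψ, preparing |x⟩ on A amounts to applying a bra ⟨x| on B,
which G_A does not see. Therefore G_A sends |x⟩ ⊗ junk to ∑_y T_yx |y⟩ ⊗ junk', with junk'
independent of x (`IsBipartite.gate_action`).

Condition 2 turns Ψ^j into an EPR source again, so that gates can be chained (`circuit_action`). The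
gates G_B serve only this purpose: being invertible on B, they do not change the subspace of vectors
M Ψ. Finally, projecting B onto x prepares P_A^x Ψ, of squared norm 2^(-n), and the product
measurements of ∑_y T_yx |y⟩ ⊗ junk have the ideal probabilities (`mixedSimulates_of_action`). -/

theorem ofFn_prod_mul {n : ℕ} (f g : Fin n → R) (h : ∀ i j, i ≠ j → Commute (f i) (g j)) :
    (List.ofFn f).prod * (List.ofFn g).prod = (List.ofFn fun i => f i * g i).prod := by
  induction n with
  | zero => simp
  | succ n ih =>
    simp only [List.ofFn_succ, List.prod_cons]
    rw [← ih (fun i => f i.succ) (fun i => g i.succ)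
      (fun i j hij => h _ _ (by simpa using hij))]
    have hc : Commute (List.ofFn fun i : Fin n => f i.succ).prod (g 0) := by
      refine Commute.list_prod_left _ _ fun x hx => ?_
      obtain ⟨i, rfl⟩ := (List.mem_ofFn' _ _).1 hx
      exact h _ _ (Fin.succ_ne_zero i)
    simp only [mul_assoc]
    rw [← mul_assoc _ (g 0), hc.eq, mul_assoc]

theorem ofFn_prod_ite {n : ℕ} (i : Fin n) (a : R) :
    (List.ofFn fun j => if j = i then a else 1).prod = a := by
  induction n with
  | zero => exact i.elim0
  | succ n ih =>
    rw [List.ofFn_succ, List.prod_cons]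
    induction i using Fin.cases with
    | zero =>
      have : (List.ofFn fun i : Fin n => if i.succ = 0 then a else 1) =
          List.replicate n 1 := by
        simp [Fin.succ_ne_zero]
      simp
    | succ i => simpa [(Fin.succ_ne_zero i).symm] using ih i

/-- The ordered product of the `f i` with `i ∈ s`. -/
def prodOn (s : Finset (Fin n)) (f : Fin n → R) : R :=
  (List.ofFn fun i => if i ∈ s then f i else 1).prod

@[simp] theorem prodOn_empty (f : Fin n → R) : prodOn ∅ f = 1 := by simp [prodOn]

theorem prodOn_univ (f : Fin n → R) : prodOn Finset.univ f = (List.ofFn f).prod := by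
  simp [prodOn]

theorem prodOn_congr {s : Finset (Fin n)} {f g : Fin n → R} (h : ∀ i ∈ s, f i = g i) :
    prodOn s f = prodOn s g := by
  unfold prodOn
  congr 2
  funext i
  split_ifs with hi
  · exact h i hi
  · rfl

theorem prodOn_mul {s : Finset (Fin n)} {f g : Fin n → R}
    (h : ∀ i j, i ≠ j → Commute (f i) (g j)) :
    prodOn s f * prodOn s g = prodOn s fun i => f i * g i := by
  unfold prodOn
  rw [ofFn_prod_mul]
  · congr 2
    funext i
    split_ifs <;> simp
  · intro i j hij
    split_ifs <;> simp [h i j hij]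

theorem prodOn_union {s t : Finset (Fin n)} {f : Fin n → R}
    (h : ∀ i j, i ≠ j → Commute (f i) (f j)) (hst : Disjoint s t) :
    prodOn (s ∪ t) f = prodOn s f * prodOn t f := by
  unfold prodOn
  rw [ofFn_prod_mul]
  · congr 2
    funext i
    by_cases hi : i ∈ s
    · simp [hi, Finset.disjoint_left.1 hst hi]
    · simp [hi]
  · intro i j hij
    split_ifs <;> simp [h i j hij]

theorem prodOn_singleton (i : Fin n) (f : Fin n → R) : prodOn {i} f = f i := by
  rw [prodOn, ← ofFn_prod_ite i (f i)]
  congr 2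
  funext j
  by_cases h : j = i <;> simp [h]

theorem prodOn_insert {s : Finset (Fin n)} {f : Fin n → R} {i : Fin n}
    (h : ∀ i j, i ≠ j → Commute (f i) (f j)) (hi : i ∉ s) :
    prodOn (insert i s) f = f i * prodOn s f := by
  rw [Finset.insert_eq, prodOn_union h (Finset.disjoint_singleton_left.2 hi), prodOn_singleton]

theorem commute_prodOn {s : Finset (Fin n)} {f : Fin n → R} {a : R}
    (h : ∀ i ∈ s, Commute a (f i)) : Commute a (prodOn s f) := by
  refine Commute.list_prod_right _ _ fun x hx => ?_
  obtain ⟨i, rfl⟩ := (List.mem_ofFn' _ _).1 hx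
  dsimp only
  split_ifs with hi
  · exact h i hi
  · exact Commute.one_right a

theorem prodOn_mem {S : Type*} [SetLike S R] [SubmonoidClass S R] (N : S) {s : Finset (Fin n)}
    {f : Fin n → R} (h : ∀ i ∈ s, f i ∈ N) : prodOn s f ∈ N := by
  refine list_prod_mem fun x hx => ?_
  obtain ⟨i, rfl⟩ := (List.mem_ofFn' _ _).1 hx
  dsimp only
  split_ifs with hi
  · exact h i hi
  · exact one_mem N

theorem map_prodOn {R' : Type*} [Monoid R'] {F : Type*} [FunLike F R R'] [MonoidHomClass F R R']
    (φ : F) (s : Finset (Fin n)) (f : Fin n → R) :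
    φ (prodOn s f) = prodOn s fun i => φ (f i) := by
  rw [prodOn, map_list_prod, List.map_ofFn, prodOn]
  congr 2
  funext i
  by_cases hi : i ∈ s <;> simp [hi]

end OrderedProducts

/-- Extension of a function on a finite subset of `Fin n`. -/
def extendBy {n : ℕ} {S : Type*} (s : Finset (Fin n)) (d : Fin n → S) (x : {i // i ∈ s} → S)
    (i : Fin n) : S :=
  if h : i ∈ s then x ⟨i, h⟩ else d i

theorem extendBy_of_mem {n : ℕ} {S : Type*} {s : Finset (Fin n)} {d : Fin n → S}
    {x : {i // i ∈ s} → S} {i : Fin n} (h : i ∈ s) : extendBy s d x i = x ⟨i, h⟩ := by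
  simp [extendBy, h]

theorem extendBy_of_notMem {n : ℕ} {S : Type*} {s : Finset (Fin n)} {d : Fin n → S}
    {x : {i // i ∈ s} → S} {i : Fin n} (h : i ∉ s) : extendBy s d x i = d i := by
  simp [extendBy, h]

/-- Distributivity for ordered products. -/
theorem prodOn_sum_smul {n : ℕ} {R : Type*} [Ring R] [Algebra ℂ R] (s : Finset (Fin n))
    (c : {i // i ∈ s} → Fin 2 → ℂ) (f : Fin n → Fin 2 → R) (d : Fin n → Fin 2)
    (e : Fin n → R) (he : ∀ i (h : i ∈ s), e i = ∑ b, c ⟨i, h⟩ b • f i b) :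
    prodOn s e =
      ∑ x : {i // i ∈ s} → Fin 2, (∏ i, c i (x i)) • prodOn s fun i => f i (extendBy s d x i) := by
  classical
  -- Freezing the factors outside `s` at `1` makes the ordered product multilinear in the remaining
  -- ones, so distributivity needs no commutation.
  let m : MultilinearMap ℂ (fun _ : {i // i ∈ s} => R) R :=
    (MultilinearMap.mkPiAlgebraFin ℂ n R).domDomRestrict (fun i => i ∈ s) fun _ => 1
  have hm : ∀ g : Fin n → R, prodOn s g = m fun i => g i := by
    intro g
    simp only [m, MultilinearMap.domDomRestrict_apply, MultilinearMap.mkPiAlgebraFin_apply]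
    unfold prodOn
    congr 2
  rw [hm]
  have h1 : (fun i : {i // i ∈ s} => e i) = fun i => ∑ b, c i b • f i b :=
    funext fun i => he i i.2
  rw [h1, MultilinearMap.map_sum]
  refine Finset.sum_congr rfl fun x _ => ?_
  rw [MultilinearMap.map_smul_univ, hm]
  congr 2
  funext i
  rw [extendBy_of_mem i.2]

/-! ### Real multilinear forms and tomography by real product states -/

/-- Induction on the number of arguments. For each fixed first argument the inductive hypothesis
supplies a proportionality vector, and what remains is to make the vectors for the two basis
arguments agree, using the zeros or values of `p` at suitable combinations of them. -/
theorem multilinear_proportional {V : Type*} [AddCommGroup V] [Module ℝ V] :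
    ∀ (m : ℕ) (p : MultilinearMap ℝ (fun _ : Fin m => Fin 2 → ℝ) ℝ)
      (q : MultilinearMap ℝ (fun _ : Fin m => Fin 2 → ℝ) V), (∀ a, p a = 0 → q a = 0) →
      ∃ χ : V, ∀ a, q a = p a • χ := by
  intro m
  induction m with
  | zero =>
    intro p q h
    -- If `p 0 = 0`, the convention `0⁻¹ = 0` gives the vector 0, which is right because then `q 0 =
    -- 0`.
    refine ⟨(p 0)⁻¹ • q 0, fun a => ?_⟩
    rw [Subsingleton.elim a 0, smul_smul]
    by_cases hp : p 0 = 0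
    · rw [h 0 hp, smul_zero]
    · rw [mul_inv_cancel₀ hp, one_smul]
  | succ m ih =>
    intro p q h
    have key : ∀ v : Fin 2 → ℝ, ∃ c : V, ∀ a, q (Fin.cons v a) = p (Fin.cons v a) • c := fun v =>
      ih (p.curryLeft v) (q.curryLeft v) fun a ha => h _ ha
    have hv : ∀ v : Fin 2 → ℝ, v = v 0 • ![1, 0] + v 1 • ![0, 1] := fun v => by
      ext i; fin_cases i <;> simp
    have linV : ∀ (v : Fin 2 → ℝ) a, q (Fin.cons v a) =
        v 0 • q (Fin.cons ![1, 0] a) + v 1 • q (Fin.cons ![0, 1] a) := by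
      intro v a
      conv_lhs => rw [hv v]
      rw [MultilinearMap.cons_add, MultilinearMap.cons_smul, MultilinearMap.cons_smul]
    have linR : ∀ (v : Fin 2 → ℝ) a, p (Fin.cons v a) =
        v 0 * p (Fin.cons ![1, 0] a) + v 1 * p (Fin.cons ![0, 1] a) := by
      intro v a
      conv_lhs => rw [hv v]
      rw [MultilinearMap.cons_add, MultilinearMap.cons_smul, MultilinearMap.cons_smul]
      rfl
    obtain ⟨c₀, h₀⟩ := key ![1, 0]
    obtain ⟨c₁, h₁⟩ := key ![0, 1]
    suffices hs : ∃ χ : V, (∀ a, q (Fin.cons ![1, 0] a) = p (Fin.cons ![1, 0] a) • χ) ∧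
        ∀ a, q (Fin.cons ![0, 1] a) = p (Fin.cons ![0, 1] a) • χ by
      obtain ⟨χ, e₀, e₁⟩ := hs
      refine ⟨χ, fun a => ?_⟩
      rw [← Fin.cons_self_tail a, linV, linR, e₀, e₁, add_smul, smul_smul, smul_smul]
    -- The cases are: `p` vanishes on the second basis argument; the first slice of `p` is a
    -- multiple `l` of the second; the two slices are linearly independent.
    by_cases hA : ∀ a, p (Fin.cons ![0, 1] a) = 0
    · exact ⟨c₀, h₀, fun a => by rw [h₁, hA, zero_smul, zero_smul]⟩
    by_cases hB : ∃ l : ℝ, ∀ a, p (Fin.cons ![1, 0] a) = l * p (Fin.cons ![0, 1] a)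
    · obtain ⟨l, hl⟩ := hB
      refine ⟨c₁, fun a => ?_, h₁⟩
      -- The combination (1, -l) kills `p`, hence `q`, which transports `c₁` to the first slice.
      have hz := h (Fin.cons ![1, -l] a) (by rw [linR]; simp [hl])
      rw [linV] at hz
      simp only [Matrix.cons_val_zero, Matrix.cons_val_one, one_smul, neg_smul] at hz
      rw [add_neg_eq_zero.1 hz, h₁, hl, smul_smul]
    · push Not at hA hB
      -- Linearity at (1, 1) gives a relation between the slices of `p` with coefficients `c₀ - c`
      -- and `c₁ - c`; by independence both vanish.
      obtain ⟨c, hc⟩ := key ![1, 1]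
      have e : ∀ a, p (Fin.cons ![1, 0] a) • (c₀ - c) + p (Fin.cons ![0, 1] a) • (c₁ - c) = 0 := by
        intro a
        have := hc a
        rw [linV, linR, h₀, h₁] at this
        simp only [Matrix.cons_val_zero, Matrix.cons_val_one, one_smul, one_mul, add_smul] at this
        rw [smul_sub, smul_sub, sub_add_sub_comm, this, sub_self]
      obtain ⟨a, ha⟩ := hA
      set l := p (Fin.cons ![1, 0] a) / p (Fin.cons ![0, 1] a) with hl
      have e1 : c₁ - c = -(l • (c₀ - c)) := by
        have := e a
        rw [eq_neg_iff_add_eq_zero, hl, div_eq_inv_mul, mul_smul]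
        apply smul_right_injective V ha
        simp only [smul_add, smul_zero, smul_smul]
        rw [← this, add_comm, ← mul_assoc, mul_inv_cancel₀ ha, one_mul]
      -- With `l` the ratio of the slices at `a`, independence provides a point `b` where the ratio
      -- fails.
      obtain ⟨b, hb⟩ := hB l
      have e2 : (p (Fin.cons ![1, 0] b) - l * p (Fin.cons ![0, 1] b)) • (c₀ - c) = 0 := by
        have := e b
        rw [e1, smul_neg, smul_smul, ← sub_eq_add_neg, ← sub_smul] at this
        rwa [mul_comm l]
      have e3 : c₀ - c = 0 := (smul_eq_zero.1 e2).resolve_left (sub_ne_zero.2 hb)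
      rw [e3, smul_zero, neg_zero] at e1
      exact ⟨c, fun a => by rw [h₀, sub_eq_zero.1 e3], fun a => by rw [h₁, sub_eq_zero.1 e1]⟩

/-- The real coordinates of the qubit state `|a⟩`. -/
def ketR (a : Angle) : Fin 2 → ℝ := ![Real.cos a.val, Real.sin a.val]

theorem ket_eq (a : Angle) (s : Fin 2) : ket a s = (ketR a s : ℂ) := by
  fin_cases s <;> simp [ket, ketR]

/-- In each argument separately both sides are quadratic forms on the real plane, and such a form is
determined by its values at the angles 0, π/4, π/2. The arguments are freed from the angle set one
at a time. -/
theorem sq_norm_multilinear_of_angles {κ V : Type*} [Fintype κ] [NormedAddCommGroup V]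
    [InnerProductSpace ℝ V] (p : MultilinearMap ℝ (fun _ : κ => Fin 2 → ℝ) ℝ)
    (q : MultilinearMap ℝ (fun _ : κ => Fin 2 → ℝ) V)
    (h : ∀ a : κ → Angle, ‖q fun i => ketR (a i)‖ ^ 2 = (p fun i => ketR (a i)) ^ 2)
    (a : κ → Fin 2 → ℝ) : ‖q a‖ ^ 2 = p a ^ 2 := by
  classical
  have main : ∀ (s : Finset κ) (a : κ → Fin 2 → ℝ), (∀ i ∉ s, ∃ b, a i = ketR b) →
      ‖q a‖ ^ 2 = p a ^ 2 := by
    intro s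
    induction s using Finset.induction_on with
    | empty =>
      intro a ha
      choose b hb using fun i => ha i (Finset.notMem_empty i)
      rw [funext hb]
      exact h b
    | insert i s hi ih =>
      intro a ha
      have hb : ∀ b, ‖q (Function.update a i (ketR b))‖ ^ 2 =
          p (Function.update a i (ketR b)) ^ 2 := fun b => ih _ fun j hj => by
        by_cases hji : j = i
        · subst hji; exact ⟨b, by simp⟩
        · rw [Function.update_of_ne hji]
          exact ha j (by simp [hji, hj])
      have hv : ∀ v : Fin 2 → ℝ, v = v 0 • ![1, 0] + v 1 • ![0, 1] := fun v => by
        ext i; fin_cases i <;> simp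
      set A := q (Function.update a i ![1, 0])
      set B := q (Function.update a i ![0, 1])
      set α := p (Function.update a i ![1, 0])
      set β := p (Function.update a i ![0, 1])
      have hq : ∀ v, q (Function.update a i v) = v 0 • A + v 1 • B := fun v => by
        conv_lhs => rw [hv v]
        rw [MultilinearMap.map_update_add, MultilinearMap.map_update_smul,
          MultilinearMap.map_update_smul]
      have hp : ∀ v, p (Function.update a i v) = v 0 * α + v 1 * β := fun v => by
        conv_lhs => rw [hv v]
        rw [MultilinearMap.map_update_add, MultilinearMap.map_update_smul,
          MultilinearMap.map_update_smul]
        rfl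
      have hn : ∀ x y : ℝ, ‖x • A + y • B‖ ^ 2 =
          x ^ 2 * ‖A‖ ^ 2 + 2 * (x * y * ⟪A, B⟫_ℝ) + y ^ 2 * ‖B‖ ^ 2 := fun x y => by
        rw [norm_add_sq_real, inner_smul_left, inner_smul_right, norm_smul, norm_smul, mul_pow,
          mul_pow]
        simp [mul_assoc]
      -- The labels (0, 0), (0, 1), (2, 0) are the angles 0, π/2, π/4: the first two fix the
      -- diagonal terms, the third the cross term.
      have h0 := hb (0, 0)
      have h1 := hb (0, 1)
      have h2 := hb (2, 0)
      rw [hq, hp, hn] at h0 h1 h2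
      have e2 : (2 : ℝ) * (Real.pi / 8) = Real.pi / 4 := by ring
      simp only [ketR, Angle.val, Fin.isValue, Fin.val_zero, Fin.val_one, Fin.val_two,
        Matrix.cons_val_zero, Matrix.cons_val_one, CharP.cast_eq_zero, zero_mul, add_zero,
        Real.cos_zero, Real.sin_zero, Nat.cast_one, one_mul, zero_add, Real.cos_pi_div_two,
        Real.sin_pi_div_two, Nat.cast_ofNat, e2, Real.cos_pi_div_four, Real.sin_pi_div_four]
        at h0 h1 h2
      have hs : (√2 / 2 : ℝ) * (√2 / 2) = 1 / 2 := by
        have := Real.mul_self_sqrt (show (0 : ℝ) ≤ 2 by norm_num)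
        linarith
      have hs2 : (√2 / 2 : ℝ) ^ 2 = 1 / 2 := by rw [sq, hs]
      have h2' : ⟪A, B⟫_ℝ = α * β := by
        have : (√2 / 2 * α + √2 / 2 * β) ^ 2 = 1 / 2 * (α + β) ^ 2 := by rw [← hs2]; ring
        rw [this, hs, hs2] at h2
        linarith
      rw [← Function.update_eq_self i a, hq, hp, hn, h2']
      linear_combination (a i 0) ^ 2 * h0 + (a i 1) ^ 2 * h1
  exact main Finset.univ a fun i hi => absurd (Finset.mem_univ i) hi

/-- A vector-valued tensor whose squared norms on real product states agree with the statistics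
of a real state `p` is a multiple of `p`. -/
theorem tomography {κ V : Type*} [Fintype κ] [DecidableEq κ] [NormedAddCommGroup V]
    [InnerProductSpace ℝ V] (p : (κ → Fin 2) → ℝ) (q : (κ → Fin 2) → V)
    (h : ∀ a : κ → Angle, ‖∑ x, (∏ i, ketR (a i) (x i)) • q x‖ ^ 2 =
      (∑ x, (∏ i, ketR (a i) (x i)) * p x) ^ 2) : ∃ χ, ∀ x, q x = p x • χ := by
  let mono : (κ → Fin 2) → MultilinearMap ℝ (fun _ : κ => Fin 2 → ℝ) ℝ := fun x =>
    (MultilinearMap.mkPiAlgebra ℝ κ ℝ).compLinearMap fun i => LinearMap.proj (x i)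
  let P : MultilinearMap ℝ (fun _ : κ => Fin 2 → ℝ) ℝ := ∑ x, (mono x).smulRight (p x)
  let Q : MultilinearMap ℝ (fun _ : κ => Fin 2 → ℝ) V := ∑ x, (mono x).smulRight (q x)
  have hP : ∀ a, P a = ∑ x, (∏ i, a i (x i)) * p x := fun a => by
    simp [P, mono]
  have hQ : ∀ a, Q a = ∑ x, (∏ i, a i (x i)) • q x := fun a => by
    simp [Q, mono]
  have hsq := sq_norm_multilinear_of_angles P Q fun a => by rw [hP, hQ]; exact h a
  let e := Fintype.equivFin κ
  obtain ⟨χ, hχ⟩ := multilinear_proportional _ (P.domDomCongr e) (Q.domDomCongr e) fun a ha => by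
    have := hsq fun i => a (e i)
    rw [show P (fun i => a (e i)) = 0 from ha] at this
    exact norm_eq_zero.1 (pow_eq_zero_iff two_ne_zero |>.1 (by simpa using this))
  refine ⟨χ, fun x => ?_⟩
  -- Standard basis arguments isolate the coefficient at `x`.
  have hx := hχ fun i => Pi.single (x (e.symm i)) 1
  simp only [MultilinearMap.domDomCongr_apply, Equiv.symm_apply_apply, hP, hQ] at hx
  have hδ : ∀ y : κ → Fin 2, (∏ i, (Pi.single (x i) 1 : Fin 2 → ℝ) (y i)) =
      if y = x then 1 else 0 := fun y => by
    split_ifs with hyx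
    · simp [hyx]
    · obtain ⟨i, hi⟩ := Function.ne_iff.1 hyx
      exact Finset.prod_eq_zero (Finset.mem_univ i) (by simp [hi])
  simpa [hδ] using hx

/-! ### The amplification `M ↦ M ⊗ Id` -/

section Amplification

variable {X Y Z : Type*}

theorem hasSum_inner_slice (e : X ≃ Y × Z) (f g : L2 X) :
    HasSum (fun z => ⟪slice e f z, slice e g z⟫_ℂ) ⟪f, g⟫_ℂ := by
  have h := lp.hasSum_inner (𝕜 := ℂ) f g
  have h1 : HasSum (fun p : Z × Y => ⟪f (e.symm (p.2, p.1)), g (e.symm (p.2, p.1))⟫_ℂ) ⟪f, g⟫_ℂ :=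
    (((Equiv.prodComm Z Y).trans e.symm).hasSum_iff (f := fun x => ⟪f x, g x⟫_ℂ)).2 h
  exact h1.prod_fiberwise fun z => lp.hasSum_inner (𝕜 := ℂ) (slice e f z) (slice e g z)

theorem slice_amp (e : X ≃ Y × Z) (M : Op Y) (f : L2 X) (z : Z) :
    slice e (amp e M f) z = M (slice e f z) := by
  ext y
  simp

theorem amp_mul (e : X ≃ Y × Z) (M N : Op Y) : amp e (M * N) = amp e M * amp e N := by
  ext f x
  simp [slice_amp]

theorem amp_one (e : X ≃ Y × Z) : amp e (1 : Op Y) = 1 := by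
  ext f x
  simp

theorem amp_star (e : X ≃ Y × Z) (M : Op Y) : amp e (star M) = star (amp e M) := by
  rw [ContinuousLinearMap.star_eq_adjoint, ContinuousLinearMap.star_eq_adjoint,
    ContinuousLinearMap.eq_adjoint_iff]
  intro f g
  refine (hasSum_inner_slice e _ _).unique ?_
  simp only [slice_amp, ContinuousLinearMap.adjoint_inner_left]
  simpa only [slice_amp] using hasSum_inner_slice e f (amp e M g)

/-- The amplification as a homomorphism of `*`-algebras. -/
def ampHom (e : X ≃ Y × Z) : Op Y →⋆ₐ[ℂ] Op X where
  toFun := amp e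
  map_one' := amp_one e
  map_mul' := amp_mul e
  map_zero' := by ext f x; simp
  map_add' M N := by ext f x; simp
  commutes' c := by ext f x; simp [Algebra.algebraMap_eq_smul_one]
  map_star' := amp_star e

@[simp] theorem ampHom_apply (e : X ≃ Y × Z) (M : Op Y) : ampHom e M = amp e M := rfl

open Classical in
theorem op_ext_single {M N : Op X} (h : ∀ x, M (lp.single 2 x 1) = N (lp.single 2 x 1)) :
    M = N := by
  refine lp.ext_continuousLinearMap ENNReal.ofNat_ne_top fun x => ?_
  ext1
  exact h x

open Classical in
theorem slice_single (e : X ≃ Y × Z) (x : X) (z : Z) :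
    slice e (lp.single 2 x (1 : ℂ)) z =
      if z = (e x).2 then lp.single 2 (e x).1 (1 : ℂ) else 0 := by
  ext y
  have h : e.symm (y, z) = x ↔ y = (e x).1 ∧ z = (e x).2 := by
    rw [Equiv.symm_apply_eq, Prod.ext_iff]
  by_cases hz : z = (e x).2
  · simp only [slice_apply, lp.single_apply, hz, if_true, Pi.single_apply]
    rw [hz] at h
    simp [h]
  · simp [hz, h]

open Classical in
-- The matrix entry factors into an entry of `M` and one of `N`. The condition in the `if`
-- overwrites both coordinates of `x` by those of `x₀`, so it says that `x` and `x₀` agree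
-- everywhere else. The result is symmetric in the two operators, whence `commute_amp`.
theorem amp_amp_single {Y' Z' : Type*} (e : X ≃ Y × Z) (e' : X ≃ Y' × Z')
    (h : ∀ x y, (e' (e.symm (y, (e x).2))).1 = (e' x).1)
    (hc : ∀ x y y', e.symm (y, (e (e'.symm (y', (e' x).2))).2) =
      e'.symm (y', (e' (e.symm (y, (e x).2))).2))
    (M : Op Y) (N : Op Y') (x₀ x : X) :
    amp e M (amp e' N (lp.single 2 x₀ 1)) x =
      if e.symm ((e x₀).1, (e (e'.symm ((e' x₀).1, (e' x).2))).2) = x₀ then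
        M (lp.single 2 (e x₀).1 1) (e x).1 * N (lp.single 2 (e' x₀).1 1) (e' x).1 else 0 := by
  have key : slice e (amp e' N (lp.single 2 x₀ 1)) (e x).2 =
      (if e.symm ((e x₀).1, (e (e'.symm ((e' x₀).1, (e' x).2))).2) = x₀ then
        N (lp.single 2 (e' x₀).1 1) (e' x).1 else 0) • lp.single 2 (e x₀).1 (1 : ℂ) := by
    ext y
    have h1 : (e' (e.symm (y, (e x).2))).2 = (e' x₀).2 ↔
        e.symm ((e x₀).1, (e (e'.symm ((e' x₀).1, (e' x).2))).2) = x₀ ∧ y = (e x₀).1 := by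
      have h2 : (e' (e.symm (y, (e x).2))).2 = (e' x₀).2 ↔
          e'.symm ((e' x₀).1, (e' (e.symm (y, (e x).2))).2) = x₀ := by
        rw [Equiv.symm_apply_eq, Prod.ext_iff]
        simp
      rw [h2, ← hc]
      constructor
      · intro h3
        have h4 : y = (e x₀).1 := by
          have := congrArg (fun w => (e w).1) h3
          simpa using this
        exact ⟨h4 ▸ h3, h4⟩
      · rintro ⟨h3, rfl⟩
        exact h3
    simp only [slice_apply, amp_apply, slice_single]
    by_cases hy : y = (e x₀).1
    · subst hy
      by_cases hx : e.symm ((e x₀).1, (e (e'.symm ((e' x₀).1, (e' x).2))).2) = x₀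
      · rw [if_pos (h1.2 ⟨hx, rfl⟩), if_pos hx, h]
        simp
      · rw [if_neg (fun hh => hx (h1.1 hh).1), if_neg hx]
        simp
    · rw [if_neg (fun hh => hy (h1.1 hh).2)]
      split_ifs <;> simp [hy]
  rw [amp_apply, key, map_smul]
  simp only [lp.coeFn_smul, Pi.smul_apply, smul_eq_mul]
  split_ifs <;> ring

/-- Amplifications that act on different coordinates commute. -/
theorem commute_amp {Y' Z' : Type*} (e : X ≃ Y × Z) (e' : X ≃ Y' × Z')
    (h : ∀ x y, (e' (e.symm (y, (e x).2))).1 = (e' x).1)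
    (h' : ∀ x y, (e (e'.symm (y, (e' x).2))).1 = (e x).1)
    (hc : ∀ x y y', e.symm (y, (e (e'.symm (y', (e' x).2))).2) =
      e'.symm (y', (e' (e.symm (y, (e x).2))).2))
    (M : Op Y) (N : Op Y') : Commute (amp e M) (amp e' N) := by
  classical
  refine op_ext_single fun x₀ => ?_
  ext x
  rw [mul_apply_eq_comp, mul_apply_eq_comp, amp_amp_single e e' h hc,
    amp_amp_single e' e h' fun x y y' => (hc x y' y).symm]
  have := hc x (e x₀).1 (e' x₀).1
  rw [this]
  split_ifs <;> ring

theorem commute_onA_onB (M : Op X) (N : Op Y) : Commute (onA (Y := Y) M) (onB (X := X) N) :=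
  commute_amp _ _ (fun _ _ => rfl) (fun _ _ => rfl) (fun _ _ _ => rfl) M N

variable {n : ℕ} {α : Fin n → Type*}

theorem commute_onReg {i j : Fin n} (hij : i ≠ j) (M : Op (α i)) (N : Op (α j)) :
    Commute (onReg i M) (onReg j N) := by
  refine commute_amp _ _ ?_ ?_ ?_ M N
  · intro x y
    simp [Equiv.piSplitAt, hij.symm]
  · intro x y
    simp [Equiv.piSplitAt, hij]
  · intro x y y'
    funext k
    by_cases hi : k = i
    · subst hi; simp [Equiv.piSplitAt, hij]
    · by_cases hj : k = j
      · subst hj; simp [Equiv.piSplitAt, hij.symm]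
      · simp [Equiv.piSplitAt, hi, hj]

theorem commute_onReg_onSubset {i : Fin n} {I : Finset (Fin n)} (hi : i ∉ I) (M : Op (α i))
    (N : Op (∀ i : {i // i ∈ I}, α i)) : Commute (onReg i M) (onSubset I N) := by
  refine commute_amp _ _ ?_ ?_ ?_ M N
  · intro x y
    funext k
    have : (k : Fin n) ≠ i := fun h => hi (h ▸ k.2)
    simp [Equiv.piSplitAt, Equiv.piEquivPiSubtypeProd, this]
  · intro x y
    simp [Equiv.piSplitAt, Equiv.piEquivPiSubtypeProd, hi]
  · intro x y y'
    funext k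
    by_cases hk : k = i
    · subst hk; simp [Equiv.piSplitAt, Equiv.piEquivPiSubtypeProd, hi]
    · by_cases hj : k ∈ I
      · simp [Equiv.piSplitAt, Equiv.piEquivPiSubtypeProd, hk, hj]
      · simp [Equiv.piSplitAt, Equiv.piEquivPiSubtypeProd, hk, hj]

end Amplification

/-! ### Traces against reduced states -/

section Trace

variable {X Y : Type*}

theorem contract_onA (G : Op X) (ξ : L2 (X × Y)) :
    contract (onA G ξ) = (contract ξ).comp (star G) := by
  ext f y
  rw [ContinuousLinearMap.comp_apply, contract_apply, contract_apply, onA, slice_amp,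
    ContinuousLinearMap.star_eq_adjoint, ContinuousLinearMap.adjoint_inner_right]

theorem reducedState_onA (G : Op X) (ξ : L2 (X × Y)) :
    reducedState (onA G ξ) = G * reducedState ξ * star G := by
  rw [reducedState, contract_onA, ContinuousLinearMap.adjoint_comp,
    ← ContinuousLinearMap.star_eq_adjoint (star G), star_star]
  rfl

open Classical in
-- The inner product of `ξ` and `onA M ξ` is a convergent sum over `X × Y`; summing first over `Y`
-- produces the diagonal entries of the product, so summability of the trace comes for free.
theorem hasTrace_mul_reducedState (M : Op X) (ξ : L2 (X × Y)) :
    HasTrace (M * reducedState ξ) ⟪ξ, onA M ξ⟫_ℂ := by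
  have h := lp.hasSum_inner (𝕜 := ℂ) ξ (onA M ξ)
  refine (h.prod_fiberwise fun x => ?_)
  have h1 := hasSum_reducedState ξ (star M (lp.single 2 x 1)) (lp.single 2 x 1)
  rw [ContinuousLinearMap.star_eq_adjoint, ContinuousLinearMap.adjoint_inner_left] at h1
  have hterm : (fun y => ⟪ξ (x, y), onA M ξ (x, y)⟫_ℂ) = fun y =>
      ⟪ContinuousLinearMap.adjoint M (lp.single 2 x 1), slice (Equiv.refl _) ξ y⟫_ℂ *
        ⟪slice (Equiv.refl _) ξ y, lp.single 2 x 1⟫_ℂ := by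
    funext y
    rw [ContinuousLinearMap.adjoint_inner_left, lp.inner_single_left, lp.inner_single_right]
    simp [onA]
  rw [hterm]
  exact h1

end Trace

/-! ### Qubits inside a Hilbert space -/

section Qubit

variable {H : Type*} [NormedAddCommGroup H] [InnerProductSpace ℂ H]

/-- The `±1`-valued observable of the `k`-th measurement. -/
def observable (P : Angle → H →L[ℂ] H) (k : Fin 3) : H →L[ℂ] H := P (k, 0) - P (k, 1)

/-- The observable at angle `0`, an analogue of the Pauli matrix `Z`. -/
abbrev pauliZ (P : Angle → H →L[ℂ] H) : H →L[ℂ] H := observable P 0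

/-- The observable at angle `π/4`, an analogue of the Pauli matrix `X`. -/
abbrev pauliX (P : Angle → H →L[ℂ] H) : H →L[ℂ] H := observable P 2

/-- The analogue of `|s⟩⟨0| + |s + 1⟩⟨1|`. -/
def raise (P : Angle → H →L[ℂ] H) (s : Fin 2) : H →L[ℂ] H := pauliX P ^ (s : ℕ)

/-- The analogue of `|0⟩⟨s|`. -/
def lower (P : Angle → H →L[ℂ] H) (s : Fin 2) : H →L[ℂ] H := raise P s * P (bitAngle s)

/-- An operator that maps `|0⟩` to `|a⟩`. -/
def ketOp (P : Angle → H →L[ℂ] H) (a : Angle) : H →L[ℂ] H := ∑ s, ket a s • raise P s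

/-- The analogue of `|0⟩⟨a|`. -/
def braOp (P : Angle → H →L[ℂ] H) (a : Angle) : H →L[ℂ] H := ∑ s, ket a s • lower P s

section Commute

variable {P : Angle → H →L[ℂ] H} {M : H →L[ℂ] H}

theorem commute_observable (h : ∀ a, Commute M (P a)) (k : Fin 3) : Commute M (observable P k) :=
  (h _).sub_right (h _)

theorem commute_raise (h : ∀ a, Commute M (P a)) (s : Fin 2) : Commute M (raise P s) :=
  (commute_observable h 2).pow_right _

theorem commute_lower (h : ∀ a, Commute M (P a)) (s : Fin 2) : Commute M (lower P s) :=
  (commute_raise h s).mul_right (h _)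

theorem commute_ketOp (h : ∀ a, Commute M (P a)) (a : Angle) : Commute M (ketOp P a) :=
  Commute.sum_right _ _ _ fun s _ => (commute_raise h s).smul_right _

theorem commute_braOp (h : ∀ a, Commute M (P a)) (a : Angle) : Commute M (braOp P a) :=
  Commute.sum_right _ _ _ fun s _ => (commute_lower h s).smul_right _

end Commute

section Mem

variable {P : Angle → H →L[ℂ] H} (S : Subalgebra ℂ (H →L[ℂ] H))

theorem observable_mem (h : ∀ a, P a ∈ S) (k : Fin 3) : observable P k ∈ S := S.sub_mem (h _) (h _)

theorem raise_mem (h : ∀ a, P a ∈ S) (s : Fin 2) : raise P s ∈ S :=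
  S.pow_mem (observable_mem S h 2) _

theorem lower_mem (h : ∀ a, P a ∈ S) (s : Fin 2) : lower P s ∈ S :=
  S.mul_mem (raise_mem S h s) (h _)

theorem ketOp_mem (h : ∀ a, P a ∈ S) (a : Angle) : ketOp P a ∈ S :=
  S.sum_mem fun s _ => S.smul_mem (raise_mem S h s) _

end Mem

/-- The subalgebra of operators that preserve `K`. -/
def stabilizer (K : Submodule ℂ H) : Subalgebra ℂ (H →L[ℂ] H) where
  carrier := {M | ∀ v ∈ K, M v ∈ K}
  mul_mem' hM hN v hv := hM _ (hN v hv)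
  add_mem' hM hN v hv := K.add_mem (hM v hv) (hN v hv)
  algebraMap_mem' c v hv := by
    rw [Algebra.algebraMap_eq_smul_one]
    exact K.smul_mem c hv

theorem ketOp_apply {P : Angle → H →L[ℂ] H} (a : Angle) (v : H) :
    ketOp P a v = ((Real.cos a.val : ℝ) : ℂ) • v + ((Real.sin a.val : ℝ) : ℂ) • pauliX P v := by
  simp [ketOp, raise, ket, Fin.sum_univ_two]

/-- Analogue of being in the state `|0⟩`. -/
def IsGround (P : Angle → H →L[ℂ] H) (v : H) : Prop := P (bitAngle 0) v = v

namespace IsGround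

variable {P : Angle → H →L[ℂ] H} {v : H}

theorem of_commute (hv : IsGround P v) {M : H →L[ℂ] H} (hM : Commute M (P (bitAngle 0))) :
    IsGround P (M v) := by
  have := DFunLike.congr_fun hM.eq v
  simp only [mul_apply_eq_comp] at this
  rw [IsGround, ← this, hv]

theorem smul (hv : IsGround P v) (c : ℂ) : IsGround P (c • v) := by
  rw [IsGround, map_smul, hv]

end IsGround

variable [CompleteSpace H]

/-- A family of orthogonal measurements on a Hilbert space. -/
structure IsMeasurement (P : Angle → H →L[ℂ] H) : Prop where
  isStarProjection : ∀ a, IsStarProjection (P a)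
  add_eq_one : ∀ k, P (k, 0) + P (k, 1) = 1

namespace IsMeasurement

variable {P : Angle → H →L[ℂ] H}

theorem mul_self (hP : IsMeasurement P) (a : Angle) : P a * P a = P a :=
  (hP.isStarProjection a).isIdempotentElem

theorem apply_apply (hP : IsMeasurement P) (a : Angle) (v : H) : P a (P a v) = P a v :=
  DFunLike.congr_fun (hP.mul_self a) v

theorem inner_left (hP : IsMeasurement P) (a : Angle) (v w : H) : ⟪P a v, w⟫_ℂ = ⟪v, P a w⟫_ℂ := by
  have h : star (P a) = P a := (hP.isStarProjection a).isSelfAdjoint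
  conv_lhs => rw [← h, ContinuousLinearMap.star_eq_adjoint]
  exact ContinuousLinearMap.adjoint_inner_left _ _ _

theorem proj_one (hP : IsMeasurement P) (k : Fin 3) : P (k, 1) = 1 - P (k, 0) := by
  rw [← hP.add_eq_one k, add_sub_cancel_left]

theorem observable_eq (hP : IsMeasurement P) (k : Fin 3) :
    observable P k = 2 * P (k, 0) - 1 := by
  rw [observable, hP.proj_one]; noncomm_ring

theorem observable_mul_self (hP : IsMeasurement P) (k : Fin 3) :
    observable P k * observable P k = 1 := by
  have h : (2 * P (k, 0) - 1) * (2 * P (k, 0) - 1) =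
      4 * (P (k, 0) * P (k, 0)) - 4 * P (k, 0) + 1 := by noncomm_ring
  rw [hP.observable_eq, h, hP.mul_self, sub_self, zero_add]

theorem observable_observable (hP : IsMeasurement P) (k : Fin 3) (v : H) :
    observable P k (observable P k v) = v :=
  DFunLike.congr_fun (hP.observable_mul_self k) v

theorem isSelfAdjoint_observable (hP : IsMeasurement P) (k : Fin 3) :
    IsSelfAdjoint (observable P k) :=
  (hP.isStarProjection _).isSelfAdjoint.sub (hP.isStarProjection _).isSelfAdjoint

theorem observable_mem_unitary (hP : IsMeasurement P) (k : Fin 3) :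
    observable P k ∈ unitary (H →L[ℂ] H) := by
  rw [Unitary.mem_iff, hP.isSelfAdjoint_observable k, hP.observable_mul_self k]
  exact ⟨rfl, rfl⟩

theorem raise_mem_unitary (hP : IsMeasurement P) (s : Fin 2) :
    raise P s ∈ unitary (H →L[ℂ] H) :=
  pow_mem (hP.observable_mem_unitary 2) _

theorem observable_inner_left (hP : IsMeasurement P) (k : Fin 3) (v w : H) :
    ⟪observable P k v, w⟫_ℂ = ⟪v, observable P k w⟫_ℂ := by
  simp only [observable, sub_apply, inner_sub_left, inner_sub_right,
    hP.inner_left]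

theorem proj_apply_eq (hP : IsMeasurement P) (k : Fin 3) (s : Fin 2) (v : H) :
    P (k, s) v = (2⁻¹ : ℂ) • (v + (-1 : ℂ) ^ (s : ℕ) • observable P k v) := by
  have h2 : (2 : H →L[ℂ] H) (P (k, 0) v) = (2 : ℂ) • P (k, 0) v := by
    rw [two_smul, ← one_add_one_eq_two, add_apply]; rfl
  have h0 : observable P k v = (2 : ℂ) • P (k, 0) v - v := by
    rw [hP.observable_eq, ← h2]; rfl
  fin_cases s
  · simp only [h0]
    simp
  · simp only [h0, Fin.mk_one, hP.proj_one]
    simp only [sub_apply, one_apply_eq_self]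
    simp only [pow_one]
    module

theorem raise_mul_raise (hP : IsMeasurement P) (s : Fin 2) : raise P s * raise P s = 1 := by
  rw [raise, ← (Commute.refl (pauliX P)).mul_pow, hP.observable_mul_self, one_pow]

theorem raise_mul_lower (hP : IsMeasurement P) (s : Fin 2) :
    raise P s * lower P s = P (bitAngle s) := by
  rw [lower, ← mul_assoc, hP.raise_mul_raise, one_mul]

theorem sum_raise_mul_lower (hP : IsMeasurement P) : ∑ s, raise P s * lower P s = 1 := by
  simp only [hP.raise_mul_lower, Fin.sum_univ_two]
  exact hP.add_eq_one 0

theorem norm_sq_add (hP : IsMeasurement P) (k : Fin 3) (v : H) :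
    ‖P (k, 0) v‖ ^ 2 + ‖P (k, 1) v‖ ^ 2 = ‖v‖ ^ 2 := by
  have h : ∀ a, ‖P a v‖ ^ 2 = (⟪v, P a v⟫_ℂ).re := fun a => by
    rw [← hP.apply_apply, ← hP.inner_left, hP.apply_apply]
    exact (inner_self_eq_norm_sq (𝕜 := ℂ) _).symm
  rw [h, h, ← Complex.add_re, ← inner_add_right, ← add_apply, hP.add_eq_one]
  exact inner_self_eq_norm_sq (𝕜 := ℂ) v

end IsMeasurement

theorem norm_of_mem_unitary {U : H →L[ℂ] H} (hU : U ∈ unitary (H →L[ℂ] H)) (v : H) :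
    ‖U v‖ = ‖v‖ :=
  ContinuousLinearMap.norm_map_of_mem_unitary hU v

/-- On the invariant subspace `K`, the measurements are those of a qubit at the given angles. -/
structure IsQubit (P : Angle → H →L[ℂ] H) (K : Submodule ℂ H) : Prop extends IsMeasurement P where
  mem : ∀ a, ∀ v ∈ K, P a v ∈ K
  anticommute : ∀ v ∈ K, pauliX P (pauliZ P v) = -pauliZ P (pauliX P v)
  diagonal : ∀ v ∈ K, (√2 : ℂ) • observable P 1 v = pauliZ P v + pauliX P v

theorem cos_two_val (k : Fin 3) (s : Fin 2) :
    Real.cos (2 * Angle.val (k, s)) = (-1) ^ (s : ℕ) * Real.cos ((k : ℕ) * (Real.pi / 4)) := by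
  fin_cases s
  · simp [Angle.val]; congr 1; ring
  · have : 2 * Angle.val (k, 1) = (k : ℕ) * (Real.pi / 4) + Real.pi := by
      simp [Angle.val]; ring
    simp [this]

theorem sin_two_val (k : Fin 3) (s : Fin 2) :
    Real.sin (2 * Angle.val (k, s)) = (-1) ^ (s : ℕ) * Real.sin ((k : ℕ) * (Real.pi / 4)) := by
  fin_cases s
  · simp [Angle.val]; congr 1; ring
  · have : 2 * Angle.val (k, 1) = (k : ℕ) * (Real.pi / 4) + Real.pi := by
      simp [Angle.val]; ring
    simp [this]

namespace IsQubit

variable {P : Angle → H →L[ℂ] H} {K : Submodule ℂ H}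

theorem mem_stabilizer (h : IsQubit P K) (a : Angle) : P a ∈ stabilizer K := h.mem a

theorem observable_apply (h : IsQubit P K) (k : Fin 3) {v : H} (hv : v ∈ K) :
    observable P k v = ((Real.cos ((k : ℕ) * (Real.pi / 4)) : ℝ) : ℂ) • pauliZ P v +
      ((Real.sin ((k : ℕ) * (Real.pi / 4)) : ℝ) : ℂ) • pauliX P v := by
  have h2 : ((2 : ℕ) : ℝ) * (Real.pi / 4) = Real.pi / 2 := by push_cast; ring
  fin_cases k
  · simp
  · have := h.diagonal v hv
    have hs : (√2 : ℂ) * √2 = 2 := by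
      rw [← Complex.ofReal_mul, Real.mul_self_sqrt (by norm_num)]; norm_num
    have e : observable P 1 v = ((√2 : ℂ) / 2) • ((√2 : ℂ) • observable P 1 v) := by
      rw [smul_smul, div_mul_eq_mul_div, hs]; simp
    simp only [Fin.mk_one, Nat.cast_one, one_mul, Real.cos_pi_div_four,
      Real.sin_pi_div_four]
    rw [e, this, smul_add]
    push_cast
    rfl
  · simp only [Fin.reduceFinMk, h2, Real.cos_pi_div_two, Real.sin_pi_div_two]
    simp

theorem proj_apply (h : IsQubit P K) (a : Angle) {v : H} (hv : v ∈ K) :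
    P a v = (2⁻¹ : ℂ) • (v + ((Real.cos (2 * a.val) : ℝ) : ℂ) • pauliZ P v +
      ((Real.sin (2 * a.val) : ℝ) : ℂ) • pauliX P v) := by
  obtain ⟨k, s⟩ := a
  rw [h.proj_apply_eq, h.observable_apply k hv, cos_two_val, sin_two_val]
  push_cast
  module

theorem braOp_apply (h : IsMeasurement P) (a : Angle) (v : H) :
    braOp P a v = (2⁻¹ : ℂ) • (((Real.cos a.val : ℝ) : ℂ) • (v + pauliZ P v) +
      ((Real.sin a.val : ℝ) : ℂ) • (pauliX P v - pauliX P (pauliZ P v))) := by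
  simp only [braOp, lower, raise, ket, Fin.sum_univ_two, bitAngle, add_apply,
    smul_apply, mul_apply_eq_comp, h.proj_apply_eq]
  simp
  module

/-- With c = cos a and s = sin a, expand (c + sX)(c(1 + Z) + s(X - XZ))/2. Since X² = 1, the terms
in XZ cancel and (1 + cos 2a Z + sin 2a X)/2 remains, which is the projector on `K`. -/
theorem proj_eq_ketOp_braOp (h : IsQubit P K) (a : Angle) {v : H} (hv : v ∈ K) :
    P a v = ketOp P a (braOp P a v) := by
  rw [h.proj_apply a hv, ketOp_apply, braOp_apply h.toIsMeasurement, Real.cos_two_mul',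
    Real.sin_two_mul]
  simp only [map_add, map_sub, map_smul, h.observable_observable]
  have hcs : ((Real.cos a.val : ℝ) : ℂ) ^ 2 + ((Real.sin a.val : ℝ) : ℂ) ^ 2 = 1 := by
    rw [← Complex.ofReal_pow, ← Complex.ofReal_pow, ← Complex.ofReal_add,
      Real.cos_sq_add_sin_sq, Complex.ofReal_one]
  conv_lhs => enter [2, 1, 1]; rw [← one_smul ℂ v, ← hcs]
  push_cast
  module

end IsQubit

namespace IsGround

variable {P : Angle → H →L[ℂ] H} {K : Submodule ℂ H} {v : H}

theorem pauliZ_apply (hP : IsMeasurement P) (hv : IsGround P v) : pauliZ P v = v := by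
  have h := hP.proj_apply_eq 0 0 v
  rw [show P (0, 0) v = v from hv] at h
  have : (2 : ℂ) • v = v + pauliZ P v := by
    conv_lhs => rw [h]
    simp
  rw [two_smul] at this
  exact (add_left_cancel this).symm

theorem pauliZ_pauliX (h : IsQubit P K) (hK : v ∈ K) (hv : IsGround P v) :
    pauliZ P (pauliX P v) = -pauliX P v := by
  have := h.anticommute v hK
  rw [hv.pauliZ_apply h.toIsMeasurement] at this
  exact (neg_eq_iff_eq_neg.2 this).symm

theorem inner_pauliX (h : IsQubit P K) (hK : v ∈ K) (hv : IsGround P v) :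
    ⟪v, pauliX P v⟫_ℂ = 0 := by
  have h1 := h.observable_inner_left 0 v (pauliX P v)
  rw [hv.pauliZ_pauliX h hK, hv.pauliZ_apply h.toIsMeasurement, inner_neg_right] at h1
  have h2 : (2 : ℂ) * ⟪v, pauliX P v⟫_ℂ = 0 := by linear_combination h1
  simpa using h2

theorem norm_ketOp (h : IsQubit P K) (hK : v ∈ K) (hv : IsGround P v) (a : Angle) :
    ‖ketOp P a v‖ = ‖v‖ := by
  have hn : ‖ketOp P a v‖ ^ 2 = ‖v‖ ^ 2 := by
    rw [ketOp_apply, @norm_add_sq ℂ, inner_smul_left, inner_smul_right,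
      hv.inner_pauliX h hK, norm_smul, norm_smul,
      norm_of_mem_unitary (h.observable_mem_unitary 2)]
    simp only [Complex.norm_real, mul_pow, Real.norm_eq_abs, sq_abs, mul_zero, map_zero, add_zero]
    rw [← add_mul, Real.cos_sq_add_sin_sq, one_mul]
  exact (sq_eq_sq₀ (norm_nonneg _) (norm_nonneg _)).1 hn

/-- This is |a⟩⟨a|s⟩ = ⟨a|s⟩|a⟩: Z fixes a ground vector and changes the sign of its image under X,
so `braOp` returns the ground vector times the coefficient. -/
theorem proj_raise (h : IsQubit P K) (hK : v ∈ K) (hv : IsGround P v) (a : Angle) (s : Fin 2) :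
    P a (raise P s v) = ket a s • ketOp P a v := by
  have hr : raise P s v ∈ K := raise_mem (stabilizer K) h.mem_stabilizer s v hK
  rw [h.proj_eq_ketOp_braOp a hr, ← map_smul]
  congr 1
  rw [IsQubit.braOp_apply h.toIsMeasurement]
  fin_cases s
  · simp [raise, ket, hv.pauliZ_apply h.toIsMeasurement]
    module
  · simp [raise, ket, hv.pauliZ_pauliX h hK, h.observable_observable]
    module

theorem bit_raise (h : IsQubit P K) (hK : v ∈ K) (hv : IsGround P v) (s t : Fin 2) :
    P (bitAngle t) (raise P s v) = if s = t then raise P s v else 0 := by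
  rw [hv.proj_raise h hK, ketOp_apply]
  fin_cases s <;> fin_cases t <;> simp [ket, Angle.val, bitAngle, raise]

end IsGround

namespace IsQubit

variable {P : Angle → H →L[ℂ] H} {K : Submodule ℂ H} {v : H}

theorem bit_zero_pauliX (h : IsQubit P K) (hv : v ∈ K) :
    P (bitAngle 0) (pauliX P v) = pauliX P (P (bitAngle 1) v) := by
  simp only [bitAngle, h.proj_apply_eq, map_smul, map_add]
  have := h.anticommute v hv
  simp only [pauliX, pauliZ] at this
  rw [this]
  simp

theorem isGround_lower (h : IsQubit P K) (hv : v ∈ K) (s : Fin 2) : IsGround P (lower P s v) := by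
  fin_cases s
  · simp [IsGround, lower, raise, h.apply_apply]
  · have := h.bit_zero_pauliX (h.mem (bitAngle 1) v hv)
    simp [IsGround, lower, raise] at this ⊢
    rw [this, h.apply_apply]

theorem isGround_braOp (h : IsQubit P K) (hv : v ∈ K) (a : Angle) : IsGround P (braOp P a v) := by
  have h' := fun s => h.isGround_lower hv s
  simp only [IsGround] at h'
  simp [IsGround, braOp, h']

theorem braOp_mem (h : IsQubit P K) (hv : v ∈ K) (a : Angle) : braOp P a v ∈ K := by
  have : braOp P a ∈ stabilizer K := (stabilizer K).sum_mem fun s _ =>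
    (stabilizer K).smul_mem (lower_mem _ h.mem_stabilizer s) _
  exact this v hv

theorem norm_proj (h : IsQubit P K) (hv : v ∈ K) (a : Angle) : ‖P a v‖ = ‖braOp P a v‖ := by
  rw [h.proj_eq_ketOp_braOp a hv,
    (h.isGround_braOp hv a).norm_ketOp h (h.braOp_mem hv a)]

end IsQubit

end Qubit

/-! ### The EPR test -/

section EPR

variable {H : Type*} [NormedAddCommGroup H] [InnerProductSpace ℂ H]

/-- The vectors `M ψ` with `M ∈ S`. -/
def orbit (S : Subalgebra ℂ (H →L[ℂ] H)) (ψ : H) : Submodule ℂ H :=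
  (Subalgebra.toSubmodule S).map (ContinuousLinearMap.apply ℂ H ψ : (H →L[ℂ] H) →ₗ[ℂ] H)

theorem mem_orbit {S : Subalgebra ℂ (H →L[ℂ] H)} {ψ v : H} :
    v ∈ orbit S ψ ↔ ∃ M ∈ S, M ψ = v := by
  simp [orbit]

theorem self_mem_orbit (S : Subalgebra ℂ (H →L[ℂ] H)) (ψ : H) : ψ ∈ orbit S ψ :=
  mem_orbit.2 ⟨1, S.one_mem, rfl⟩

theorem apply_mem_orbit {S : Subalgebra ℂ (H →L[ℂ] H)} {ψ v : H} {M : H →L[ℂ] H} (hM : M ∈ S)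
    (hv : v ∈ orbit S ψ) : M v ∈ orbit S ψ := by
  obtain ⟨N, hN, rfl⟩ := mem_orbit.1 hv
  exact mem_orbit.2 ⟨M * N, S.mul_mem hM hN, rfl⟩

theorem Commute.apply_apply {M N : H →L[ℂ] H} (h : Commute M N) (v : H) : M (N v) = N (M v) :=
  DFunLike.congr_fun h.eq v

variable [CompleteSpace H]

/-- The vector `ψ` simulates an EPR pair with respect to the measurements `P` and `Q`. -/
structure IsEPR (P Q : Angle → H →L[ℂ] H) (ψ : H) : Prop where
  left : IsMeasurement P
  right : IsMeasurement Q
  commute : ∀ a b, Commute (P a) (Q b)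
  correlation : ∀ a b, ‖P a (Q b ψ)‖ ^ 2 = Real.cos (a.val - b.val) ^ 2 / 2

namespace IsEPR

variable {P Q : Angle → H →L[ℂ] H} {ψ : H}

theorem symm (h : IsEPR P Q ψ) : IsEPR Q P ψ where
  left := h.right
  right := h.left
  commute a b := (h.commute b a).symm
  correlation a b := by
    rw [← Commute.apply_apply (h.commute b a), h.correlation, ← Real.cos_neg, neg_sub]

/-- Splitting ψ by the `Q`-measurement of the same kind, the outcome at the orthogonal angle has
joint probability cos²(π/2)/2 = 0 with `a`. -/
theorem proj_eq_proj_proj (h : IsEPR P Q ψ) (a : Angle) : P a ψ = P a (Q a ψ) := by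
  have key : ∀ b, Real.cos (a.val - b.val) = 0 → P a (Q b ψ) = 0 := fun b hb => by
    have := h.correlation a b
    rw [hb] at this
    simpa using this
  obtain ⟨k, s⟩ := a
  have hsum : ψ = Q (k, 0) ψ + Q (k, 1) ψ := by
    rw [← add_apply, h.right.add_eq_one]; rfl
  conv_lhs => rw [hsum, map_add]
  fin_cases s
  · have : P (k, 0) (Q (k, 1) ψ) = 0 := key _ <| by
      simp [Angle.val]
    simp [this]
  · have : P (k, 1) (Q (k, 0) ψ) = 0 := key _ <| by
      simp [Angle.val]
    simp [this]

theorem proj_eq (h : IsEPR P Q ψ) (a : Angle) : P a ψ = Q a ψ := by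
  rw [h.proj_eq_proj_proj, h.symm.proj_eq_proj_proj, Commute.apply_apply (h.commute a a),
    h.left.apply_apply]

theorem observable_eq (h : IsEPR P Q ψ) (k : Fin 3) : observable P k ψ = observable Q k ψ := by
  simp [observable, h.proj_eq]

/-- Moving one of the two projectors to the other party turns an inner product, which is not itself
observed, into a joint probability. -/
theorem inner_proj (h : IsEPR P Q ψ) (a b : Angle) :
    ⟪P a ψ, P b ψ⟫_ℂ = ((Real.cos (a.val - b.val) ^ 2 / 2 : ℝ) : ℂ) := by
  rw [← h.correlation a b, h.proj_eq b, Complex.ofReal_pow,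
    Commute.apply_apply (h.commute a b)]
  refine Eq.trans ?_ (inner_self_eq_norm_sq_to_K (𝕜 := ℂ) (Q b (P a ψ)))
  rw [h.right.inner_left, h.right.apply_apply, ← Commute.apply_apply (h.commute a b),
    ← h.left.inner_left, h.left.apply_apply]

theorem inner_observable (h : IsEPR P Q ψ) (k l : Fin 3) :
    ⟪observable P k ψ, observable P l ψ⟫_ℂ =
      ((Real.cos (((k : ℕ) - (l : ℕ) : ℝ) * (Real.pi / 4)) : ℝ) : ℂ) := by
  simp only [observable, sub_apply, inner_sub_left, inner_sub_right, h.inner_proj]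
  rw [← Complex.ofReal_sub, ← Complex.ofReal_sub, ← Complex.ofReal_sub]
  congr 1
  have e : ∀ s t : Fin 2, Angle.val (k, s) - Angle.val (l, t) =
      ((k : ℕ) - (l : ℕ) : ℝ) * (Real.pi / 8) + ((s : ℕ) - (t : ℕ) : ℝ) * (Real.pi / 2) := by
    intro s t; simp [Angle.val]; ring
  have e2 : ((k : ℕ) - (l : ℕ) : ℝ) * (Real.pi / 4) =
      2 * (((k : ℕ) - (l : ℕ) : ℝ) * (Real.pi / 8)) := by ring
  rw [e2, Real.cos_two_mul']
  simp only [e]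
  simp [← sub_eq_add_neg, Real.cos_sub_pi_div_two, Real.cos_add_pi_div_two]
  ring

/-- The squared norm of the difference expands into prescribed inner products: 2 + 1 + 1 - 2 - 2 + 0
= 0. -/
theorem diagonal (h : IsEPR P Q ψ) :
    (√2 : ℂ) • observable P 1 ψ = pauliZ P ψ + pauliX P ψ := by
  rw [← sub_eq_zero, ← inner_self_eq_zero (𝕜 := ℂ)]
  have hs : (√2 : ℂ) * √2 = 2 := by
    rw [← Complex.ofReal_mul, Real.mul_self_sqrt (by norm_num)]; norm_num
  have c1 : Real.cos ((1 - 0 : ℝ) * (Real.pi / 4)) = √2 / 2 := by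
    rw [sub_zero, one_mul, Real.cos_pi_div_four]
  have c2 : Real.cos ((0 - 1 : ℝ) * (Real.pi / 4)) = √2 / 2 := by
    rw [← c1, ← Real.cos_neg]; congr 1; ring
  have c3 : Real.cos ((2 - 0 : ℝ) * (Real.pi / 4)) = 0 := by
    rw [show ((2 : ℝ) - 0) * (Real.pi / 4) = Real.pi / 2 by ring, Real.cos_pi_div_two]
  have c4 : Real.cos ((0 - 2 : ℝ) * (Real.pi / 4)) = 0 := by
    rw [show ((0 : ℝ) - 2) * (Real.pi / 4) = -(Real.pi / 2) by ring, Real.cos_neg,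
      Real.cos_pi_div_two]
  have c5 : Real.cos ((2 - 1 : ℝ) * (Real.pi / 4)) = √2 / 2 := by
    rw [← c1]; congr 1; ring
  have c6 : Real.cos ((1 - 2 : ℝ) * (Real.pi / 4)) = √2 / 2 := by
    rw [← c2]; congr 1; ring
  simp only [inner_sub_left, inner_sub_right, inner_add_left, inner_add_right, inner_smul_left,
    inner_smul_right, h.inner_observable, Fin.val_zero, Fin.val_one, Fin.val_two, Nat.cast_zero,
    Nat.cast_one, Nat.cast_ofNat, c1, c2, c3, c4, c5, c6, sub_self, zero_mul, Real.cos_zero,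
    Complex.conj_ofReal]
  push_cast
  linear_combination -hs

/-- Formally (√2 D)² = (Z + X)² reads 2 = 2 + XZ + ZX. The linear relation is known only at ψ, so
the outer D must first be brought next to ψ. -/
theorem anticommute (h : IsEPR P Q ψ) : pauliX P (pauliZ P ψ) = -pauliZ P (pauliX P ψ) := by
  have hc : ∀ k l (v : H), observable P k (observable Q l v) = observable Q l (observable P k v) :=
    fun k l v => Commute.apply_apply (commute_observable
      (fun a => (commute_observable (fun b => h.commute b a |>.symm) k).symm) l) v
  have hs : (√2 : ℂ) * √2 = 2 := by
    rw [← Complex.ofReal_mul, Real.mul_self_sqrt (by norm_num)]; norm_num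
  have h1 : (2 : ℂ) • ψ = (√2 : ℂ) • observable P 1 ((√2 : ℂ) • observable P 1 ψ) := by
    rw [map_smul, smul_smul, hs, h.left.observable_observable]
  -- The inner Z and X are handed to the other party, where they commute with D.
  have h3 : (√2 : ℂ) • observable P 1 (pauliZ P ψ + pauliX P ψ) =
      pauliZ Q ((√2 : ℂ) • observable P 1 ψ) + pauliX Q ((√2 : ℂ) • observable P 1 ψ) := by
    rw [map_add, h.observable_eq 0, h.observable_eq 2, hc, hc, smul_add, map_smul, map_smul]
  rw [h.diagonal, h3, h.diagonal, map_add, map_add, ← hc, ← hc, ← hc, ← hc, ← h.observable_eq 0,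
    ← h.observable_eq 2, h.left.observable_observable, h.left.observable_observable, two_smul] at h1
  have h2 : (pauliX P (pauliZ P ψ) + pauliZ P (pauliX P ψ)) = 0 := by
    have : ψ + ψ + (pauliX P (pauliZ P ψ) + pauliZ P (pauliX P ψ)) = ψ + ψ := by
      conv_rhs => rw [h1]
      abel
    simpa using this
  exact eq_neg_of_add_eq_zero_left h2

/-- Relations at ψ pass to `M ψ` for every `M` that commutes with the measurements. The orbit is
invariant because `P a ψ = Q a ψ` and `Q a` lies in `S`. -/
theorem isQubit (h : IsEPR P Q ψ) {S : Subalgebra ℂ (H →L[ℂ] H)}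
    (hP : ∀ M ∈ S, ∀ a, Commute M (P a)) (hQ : ∀ a, Q a ∈ S) : IsQubit P (orbit S ψ) where
  toIsMeasurement := h.left
  mem a v hv := by
    obtain ⟨M, hM, rfl⟩ := mem_orbit.1 hv
    rw [← Commute.apply_apply (hP M hM a), h.proj_eq]
    exact mem_orbit.2 ⟨M * Q a, S.mul_mem hM (hQ a), rfl⟩
  anticommute v hv := by
    obtain ⟨M, hM, rfl⟩ := mem_orbit.1 hv
    have hc := fun k v => Commute.apply_apply (commute_observable (hP M hM) k) v
    rw [← hc, ← hc, ← hc, ← hc, h.anticommute, map_neg]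
  diagonal v hv := by
    obtain ⟨M, hM, rfl⟩ := mem_orbit.1 hv
    have hc := fun k v => Commute.apply_apply (commute_observable (hP M hM) k) v
    rw [← hc, ← hc, ← hc, ← map_smul, h.diagonal, map_add]

end IsEPR

end EPR

/-! ### Registers of qubits -/

section Register

variable {H : Type*} [NormedAddCommGroup H] [InnerProductSpace ℂ H] {n : ℕ}

theorem prodOn_apply_congr {s : Finset (Fin n)} {f g : Fin n → H →L[ℂ] H} {ψ : H}
    (hf : ∀ i j, i ≠ j → Commute (f i) (f j)) (hg : ∀ i j, i ≠ j → Commute (g i) (g j))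
    (hfg : ∀ i j, i ≠ j → Commute (f i) (g j)) (h : ∀ i ∈ s, f i ψ = g i ψ) :
    prodOn s f ψ = prodOn s g ψ := by
  induction s using Finset.induction_on with
  | empty => simp
  | insert i s hi ih =>
    have hc : Commute (f i) (prodOn s g) := commute_prodOn fun j hj =>
      hfg i j fun hij => hi (hij ▸ hj)
    have hc' : Commute (g i) (prodOn s g) := commute_prodOn fun j hj =>
      hg i j fun hij => hi (hij ▸ hj)
    rw [prodOn_insert hf hi, prodOn_insert hg hi, mul_apply_eq_comp, mul_apply_eq_comp,
      ih fun j hj => h j (Finset.mem_insert_of_mem hj), Commute.apply_apply hc,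
      h i (Finset.mem_insert_self i s), ← Commute.apply_apply hc']

/-- The operator `⨂_{i ∈ s} (|x_i⟩⟨0| + |x_i + 1⟩⟨1|)`. -/
def raiseOn (P : Fin n → Angle → H →L[ℂ] H) (s : Finset (Fin n)) (x : Fin n → Fin 2) :
    H →L[ℂ] H := prodOn s fun i => raise (P i) (x i)

/-- The operator `⨂_{i ∈ s} |0⟩⟨x_i|`. -/
def lowerOn (P : Fin n → Angle → H →L[ℂ] H) (s : Finset (Fin n)) (x : Fin n → Fin 2) :
    H →L[ℂ] H := prodOn s fun i => lower (P i) (x i)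

/-- Measurements on different registers commute. -/
def PairwiseCommute (P : Fin n → Angle → H →L[ℂ] H) : Prop :=
  ∀ i j, i ≠ j → ∀ a b, Commute (P i a) (P j b)

namespace PairwiseCommute

variable {P : Fin n → Angle → H →L[ℂ] H} (hP : PairwiseCommute P) {i j : Fin n} (hij : i ≠ j)
include hP hij

theorem raise_proj (s : Fin 2) (b : Angle) : Commute (raise (P i) s) (P j b) :=
  (commute_raise (fun a => hP j i hij.symm b a) s).symm

theorem raise_raise (s t : Fin 2) : Commute (raise (P i) s) (raise (P j) t) :=
  commute_raise (hP.raise_proj hij s) t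

theorem lower_proj (s : Fin 2) (b : Angle) : Commute (lower (P i) s) (P j b) :=
  (commute_lower (fun a => hP j i hij.symm b a) s).symm

theorem lower_lower (s t : Fin 2) : Commute (lower (P i) s) (lower (P j) t) :=
  commute_lower (hP.lower_proj hij s) t

theorem raise_lower (s t : Fin 2) : Commute (raise (P i) s) (lower (P j) t) :=
  commute_lower (hP.raise_proj hij s) t

theorem ketOp_proj (a b : Angle) : Commute (ketOp (P i) a) (P j b) :=
  (commute_ketOp (fun c => hP j i hij.symm b c) a).symm

theorem ketOp_ketOp (a b : Angle) : Commute (ketOp (P i) a) (ketOp (P j) b) :=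
  commute_ketOp (hP.ketOp_proj hij a) b

theorem braOp_proj (a b : Angle) : Commute (braOp (P i) a) (P j b) :=
  (commute_braOp (fun c => hP j i hij.symm b c) a).symm

theorem braOp_braOp (a b : Angle) : Commute (braOp (P i) a) (braOp (P j) b) :=
  commute_braOp (hP.braOp_proj hij a) b

end PairwiseCommute

theorem prodOn_braOp_eq_sum (P : Fin n → Angle → H →L[ℂ] H) (s : Finset (Fin n)) (a : Fin n → Angle)
    (d : Fin n → Fin 2) : prodOn s (fun i => braOp (P i) (a i)) =
      ∑ x : {i // i ∈ s} → Fin 2, (∏ i : {i // i ∈ s}, ket (a i) (x i)) •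
        lowerOn P s (extendBy s d x) :=
  prodOn_sum_smul s (fun i b => ket (a i) b) (fun i b => lower (P i) b) d _ fun _ _ => rfl

variable [CompleteSpace H]

/-- The measurements `P i` are those of independent qubits on the invariant subspace `K`. -/
structure IsRegister (P : Fin n → Angle → H →L[ℂ] H) (K : Submodule ℂ H) : Prop where
  qubit : ∀ i, IsQubit (P i) K
  commute : PairwiseCommute P

/-- Expansion of a product of the resolutions |0⟩⟨0| + |1⟩⟨1| = 1. It holds on all of `H`, since
only X² = 1 is involved and not anticommutation. -/
theorem sum_raiseOn_mul_lowerOn {P : Fin n → Angle → H →L[ℂ] H} (hP : PairwiseCommute P)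
    (hm : ∀ i, IsMeasurement (P i)) (s : Finset (Fin n)) (d : Fin n → Fin 2) :
    ∑ x : {i // i ∈ s} → Fin 2, raiseOn P s (extendBy s d x) * lowerOn P s (extendBy s d x) =
      1 := by
  have h := prodOn_sum_smul s (fun _ _ => 1) (fun i b => raise (P i) b * lower (P i) b) d
    (fun _ => 1) (fun i _ => by simp only [one_smul, (hm i).sum_raise_mul_lower])
  have h1 : prodOn s (fun _ => (1 : H →L[ℂ] H)) = 1 := by simp [prodOn]
  rw [h1] at h
  simp only [Finset.prod_const_one, one_smul] at h
  rw [h]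
  exact Finset.sum_congr rfl fun x _ => prodOn_mul fun i j hij => hP.raise_lower hij _ _

theorem raiseOn_mem_unitary {P : Fin n → Angle → H →L[ℂ] H} (hm : ∀ i, IsMeasurement (P i))
    (s : Finset (Fin n)) (x : Fin n → Fin 2) : raiseOn P s x ∈ unitary (H →L[ℂ] H) :=
  prodOn_mem _ fun i _ => (hm i).raise_mem_unitary _

namespace IsRegister

variable {P : Fin n → Angle → H →L[ℂ] H} {K : Submodule ℂ H} {v u : H} {s : Finset (Fin n)}

theorem isMeasurement (h : IsRegister P K) (i : Fin n) : IsMeasurement (P i) :=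
  (h.qubit i).toIsMeasurement

theorem raiseOn_mem (h : IsRegister P K) (s : Finset (Fin n)) (x : Fin n → Fin 2) (hv : v ∈ K) :
    raiseOn P s x v ∈ K :=
  prodOn_mem (stabilizer K) (fun i _ => raise_mem _ (h.qubit i).mem_stabilizer _) v hv

theorem lowerOn_mem (h : IsRegister P K) (s : Finset (Fin n)) (x : Fin n → Fin 2) (hv : v ∈ K) :
    lowerOn P s x v ∈ K :=
  prodOn_mem (stabilizer K) (fun i _ => lower_mem _ (h.qubit i).mem_stabilizer _) v hv

/-- Projectors become bras one register at a time: the new bra is commuted inwards to act on `v`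
first, and it keeps `v` inside `K`. -/
theorem norm_prodOn_proj (h : IsRegister P K) (s : Finset (Fin n)) (a : Fin n → Angle)
    (hv : v ∈ K) :
    ‖prodOn s (fun i => P i (a i)) v‖ = ‖prodOn s (fun i => braOp (P i) (a i)) v‖ := by
  induction s using Finset.induction_on generalizing v with
  | empty => simp
  | insert i s hi ih =>
    have hK : prodOn s (fun i => P i (a i)) v ∈ K :=
      prodOn_mem (stabilizer K) (fun i _ => (h.qubit i).mem_stabilizer _) v hv
    have hne : ∀ j ∈ s, i ≠ j := fun j hj hij => hi (hij ▸ hj)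
    have hc : Commute (braOp (P i) (a i)) (prodOn s fun i => P i (a i)) :=
      commute_prodOn fun j hj => h.commute.braOp_proj (hne j hj) _ _
    have hc' : Commute (braOp (P i) (a i)) (prodOn s fun i => braOp (P i) (a i)) :=
      commute_prodOn fun j hj => h.commute.braOp_braOp (hne j hj) _ _
    rw [prodOn_insert (fun i j hij => h.commute i j hij _ _) hi,
      prodOn_insert (fun i j hij => h.commute.braOp_braOp hij _ _) hi, mul_apply_eq_comp,
      mul_apply_eq_comp, (h.qubit i).norm_proj hK, Commute.apply_apply hc,
      ih ((h.qubit i).braOp_mem hv _), Commute.apply_apply hc']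

theorem isGround_prodOn_ketOp (h : IsRegister P K) {i : Fin n} (hi : i ∉ s) (a : Fin n → Angle)
    (hu : IsGround (P i) u) : IsGround (P i) (prodOn s (fun i => ketOp (P i) (a i)) u) :=
  hu.of_commute <| Commute.symm <| commute_prodOn fun j hj =>
    (h.commute.ketOp_proj (fun hji : j = i => hi (hji ▸ hj)) _ _).symm

theorem prodOn_ketOp_mem (h : IsRegister P K) (s : Finset (Fin n)) (a : Fin n → Angle)
    (hu : u ∈ K) : prodOn s (fun i => ketOp (P i) (a i)) u ∈ K :=
  prodOn_mem (stabilizer K) (fun i _ => ketOp_mem _ (h.qubit i).mem_stabilizer _) u hu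

theorem norm_prodOn_ketOp (h : IsRegister P K) (s : Finset (Fin n)) (a : Fin n → Angle)
    (hu : u ∈ K) (hg : ∀ i ∈ s, IsGround (P i) u) :
    ‖prodOn s (fun i => ketOp (P i) (a i)) u‖ = ‖u‖ := by
  induction s using Finset.induction_on with
  | empty => simp
  | insert i s hi ih =>
    rw [prodOn_insert (fun i j hij => h.commute.ketOp_ketOp hij _ _) hi, mul_apply_eq_comp,
      (h.isGround_prodOn_ketOp hi a (hg i (Finset.mem_insert_self i s))).norm_ketOp (h.qubit i)
        (h.prodOn_ketOp_mem s a hu), ih fun j hj => hg j (Finset.mem_insert_of_mem hj)]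

/-- The overlap of product states is the product of the overlaps; operators on the registers already
treated leave the vector ground in the next one. -/
theorem prodOn_proj_raiseOn (h : IsRegister P K) (s : Finset (Fin n)) (a : Fin n → Angle)
    (x : Fin n → Fin 2) (hu : u ∈ K) (hg : ∀ i ∈ s, IsGround (P i) u) :
    prodOn s (fun i => P i (a i)) (raiseOn P s x u) =
      (∏ i ∈ s, ket (a i) (x i)) • prodOn s (fun i => ketOp (P i) (a i)) u := by
  have h1 : prodOn s (fun i => P i (a i)) * raiseOn P s x =
      prodOn s fun i => P i (a i) * raise (P i) (x i) :=
    prodOn_mul fun i j hij => (h.commute.raise_proj hij.symm _ _).symm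
  rw [← mul_apply_eq_comp, h1]
  induction s using Finset.induction_on with
  | empty => simp
  | insert i s hi ih =>
    have hc : ∀ i j, i ≠ j →
        Commute (P i (a i) * raise (P i) (x i)) (P j (a j) * raise (P j) (x j)) := fun i j hij =>
      Commute.mul_left
        ((h.commute i j hij _ _).mul_right (h.commute.raise_proj hij.symm _ _).symm)
        ((h.commute.raise_proj hij _ _).mul_right (h.commute.raise_raise hij _ _))
    rw [prodOn_insert hc hi, mul_apply_eq_comp,
      ih (fun j hj => hg j (Finset.mem_insert_of_mem hj))
        (prodOn_mul fun i j hij => (h.commute.raise_proj hij.symm _ _).symm), map_smul,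
      mul_apply_eq_comp,
      (h.isGround_prodOn_ketOp hi a (hg i (Finset.mem_insert_self i s))).proj_raise (h.qubit i)
        (h.prodOn_ketOp_mem s a hu), smul_smul, Finset.prod_insert hi,
      prodOn_insert (fun i j hij => h.commute.ketOp_ketOp hij _ _) hi, mul_apply_eq_comp, mul_comm]

theorem isGround_lowerOn (h : IsRegister P K) (x : Fin n → Fin 2) (hv : v ∈ K) {i : Fin n}
    (hi : i ∈ s) : IsGround (P i) (lowerOn P s x v) := by
  have : lowerOn P s x = lower (P i) (x i) * lowerOn P (s.erase i) x := by
    rw [lowerOn, ← Finset.insert_erase hi,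
      prodOn_insert (fun i j hij => h.commute.lower_lower hij _ _) (Finset.notMem_erase i s),
      Finset.insert_erase hi, lowerOn]
  rw [this, mul_apply_eq_comp]
  exact (h.qubit i).isGround_lower (h.lowerOn_mem _ x hv) _

theorem bit_raiseOn (h : IsRegister P K) (x : Fin n → Fin 2) (hu : u ∈ K) {i : Fin n} (hi : i ∈ s)
    (hg : IsGround (P i) u) (t : Fin 2) :
    P i (bitAngle t) (raiseOn P s x u) = if x i = t then raiseOn P s x u else 0 := by
  have : raiseOn P s x = raise (P i) (x i) * raiseOn P (s.erase i) x := by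
    rw [raiseOn, ← Finset.insert_erase hi,
      prodOn_insert (fun i j hij => h.commute.raise_raise hij _ _) (Finset.notMem_erase i s),
      Finset.insert_erase hi, raiseOn]
  rw [this, mul_apply_eq_comp]
  refine IsGround.bit_raise (h.qubit i) (h.raiseOn_mem _ x hu) (hg.of_commute ?_) _ _
  exact Commute.symm <| commute_prodOn fun j hj =>
    (h.commute.raise_proj (Finset.ne_of_mem_erase hj) _ _).symm

theorem inner_raiseOn (h : IsRegister P K) (x y : Fin n → Fin 2) (hu : u ∈ K)
    (hg : ∀ i ∈ s, IsGround (P i) u) {i : Fin n} (hi : i ∈ s) (hxy : x i ≠ y i) :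
    ⟪raiseOn P s x u, raiseOn P s y u⟫_ℂ = 0 := by
  have h1 := (h.isMeasurement i).inner_left (bitAngle (x i)) (raiseOn P s x u) (raiseOn P s y u)
  rw [h.bit_raiseOn x hu hi (hg i hi), h.bit_raiseOn y hu hi (hg i hi), if_pos rfl,
    if_neg hxy.symm, inner_zero_right] at h1
  exact h1

/-- Strings that differ at some register are separated by its bit projectors, so the vectors are
orthogonal, and each `raiseOn` is unitary. -/
theorem norm_sq_sum_raiseOn (h : IsRegister P K) (d : Fin n → Fin 2) (hu : u ∈ K)
    (hg : ∀ i ∈ s, IsGround (P i) u) (c : ({i // i ∈ s} → Fin 2) → ℝ) :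
    ‖∑ x, (c x : ℂ) • raiseOn P s (extendBy s d x) u‖ ^ 2 = (∑ x, c x ^ 2) * ‖u‖ ^ 2 := by
  have hin : ∀ x y : {i // i ∈ s} → Fin 2, ⟪raiseOn P s (extendBy s d x) u,
      raiseOn P s (extendBy s d y) u⟫_ℂ = if y = x then ((‖u‖ ^ 2 : ℝ) : ℂ) else 0 := by
    intro x y
    split_ifs with hxy
    · rw [hxy, inner_self_eq_norm_sq_to_K,
        norm_of_mem_unitary (raiseOn_mem_unitary h.isMeasurement _ _)]
      simp
    · obtain ⟨i, hi⟩ := Function.ne_iff.1 (Ne.symm hxy)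
      exact h.inner_raiseOn _ _ hu hg i.2 (by rwa [extendBy_of_mem i.2, extendBy_of_mem i.2])
  have key : ((‖∑ x, (c x : ℂ) • raiseOn P s (extendBy s d x) u‖ ^ 2 : ℝ) : ℂ) =
      (((∑ x, c x ^ 2) * ‖u‖ ^ 2 : ℝ) : ℂ) := by
    rw [Complex.ofReal_pow]
    refine Eq.trans (inner_self_eq_norm_sq_to_K (𝕜 := ℂ)
      (∑ x, (c x : ℂ) • raiseOn P s (extendBy s d x) u)).symm ?_
    simp only [sum_inner, inner_sum, inner_smul_left, inner_smul_right, hin, Complex.conj_ofReal,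
      mul_ite, mul_zero, Finset.sum_ite_eq, Finset.mem_univ, if_true]
    rw [Finset.sum_mul]
    push_cast
    exact Finset.sum_congr rfl fun x _ => by ring
  exact_mod_cast key

end IsRegister

/-- Tomography of a pair of registers by real product measurements. -/
theorem register_tomography {P Q : Fin n → Angle → H →L[ℂ] H} {K L : Submodule ℂ H} {ψ : H}
    (hP : IsRegister P K) (hQ : IsRegister Q L) (hK : ψ ∈ K) (hL : ψ ∈ L)
    (hPQ : ∀ i j a b, Commute (P i a) (Q j b)) (hQK : ∀ i a, Q i a ∈ stabilizer K)
    (hPL : ∀ i a, P i a ∈ stabilizer L) (s : Finset (Fin n)) (d : Fin n → Fin 2)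
    (A : ({i // i ∈ s} → Fin 2) → ({i // i ∈ s} → Fin 2) → ℝ)
    (h : ∀ a b : Fin n → Angle,
      ‖prodOn s (fun i => P i (a i)) (prodOn s (fun i => Q i (b i)) ψ)‖ ^ 2 =
        (∑ x, ∑ y, (∏ i : {i // i ∈ s}, ketR (a i) (x i)) *
          (∏ i : {i // i ∈ s}, ketR (b i) (y i)) * A x y) ^ 2) :
    ∃ χ : H, ∀ x y, lowerOn P s (extendBy s d x) (lowerOn Q s (extendBy s d y) ψ) =
      (A x y : ℂ) • χ := by
  -- Only real product vectors are tested, so polarisation is carried out over ℝ.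
  let : InnerProductSpace ℝ H := InnerProductSpace.complexToReal
  let e := Equiv.sumArrowEquivProdArrow {i // i ∈ s} {i // i ∈ s} (Fin 2)
  -- Both parties are merged into one family of qubits indexed by two copies of `s`.
  obtain ⟨χ, hχ⟩ := tomography (κ := {i // i ∈ s} ⊕ {i // i ∈ s}) (fun z => A (e z).1 (e z).2)
    (fun z => lowerOn P s (extendBy s d (e z).1) (lowerOn Q s (extendBy s d (e z).2) ψ))
    (fun c => by
      let a : Fin n → Angle := extendBy s (fun _ => (0, 0)) fun i => c (.inl i)
      let b : Fin n → Angle := extendBy s (fun _ => (0, 0)) fun i => c (.inr i)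
      have ha : ∀ i : {i // i ∈ s}, a i = c (.inl i) := fun i => extendBy_of_mem i.2
      have hb : ∀ i : {i // i ∈ s}, b i = c (.inr i) := fun i => extendBy_of_mem i.2
      have hab := h a b
      have hcomm : Commute (prodOn s fun i => braOp (P i) (a i))
          (prodOn s fun i => Q i (b i)) :=
        commute_prodOn fun j _ => Commute.symm <| commute_prodOn fun i _ =>
          commute_braOp (fun a => (hPQ i j a _).symm) _
      have hcomm' : Commute (prodOn s fun i => braOp (P i) (a i))
          (prodOn s fun i => braOp (Q i) (b i)) :=
        commute_prodOn fun j _ => Commute.symm <| commute_prodOn fun i _ => Commute.symm <|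
          commute_braOp (fun b => Commute.symm <| commute_braOp (fun a => (hPQ i j a _).symm) _) _
      have hbra : (prodOn s fun i => braOp (P i) (a i)) ∈ stabilizer L :=
        prodOn_mem _ fun i _ => (stabilizer L).sum_mem fun t _ =>
          (stabilizer L).smul_mem (lower_mem _ (hPL i) t) _
      -- The projectors of `P` become bras on `K`; these commute to the inside and stay in `L`,
      -- where the projectors of `Q` are treated in the same way.
      rw [hP.norm_prodOn_proj s a (prodOn_mem (stabilizer K) (fun i _ => hQK i _) ψ hK),
        Commute.apply_apply hcomm, hQ.norm_prodOn_proj s b (hbra ψ hL),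
        ← Commute.apply_apply hcomm', prodOn_braOp_eq_sum P s a d,
        prodOn_braOp_eq_sum Q s b d] at hab
      have hl : ∑ z : {i // i ∈ s} ⊕ {i // i ∈ s} → Fin 2, (∏ i, ketR (c i) (z i)) •
          lowerOn P s (extendBy s d (e z).1) (lowerOn Q s (extendBy s d (e z).2) ψ) =
          (∑ x : {i // i ∈ s} → Fin 2, (∏ i : {i // i ∈ s}, ket (a i) (x i)) •
            lowerOn P s (extendBy s d x)) ((∑ y : {i // i ∈ s} → Fin 2,
              (∏ i : {i // i ∈ s}, ket (b i) (y i)) • lowerOn Q s (extendBy s d y)) ψ) := by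
        rw [← e.symm.sum_comp, Fintype.sum_prod_type, sum_apply]
        refine Finset.sum_congr rfl fun x _ => ?_
        rw [smul_apply, sum_apply, map_sum, Finset.smul_sum]
        refine Finset.sum_congr rfl fun y _ => ?_
        rw [Equiv.apply_symm_apply, Fintype.prod_sum_type, ← Complex.coe_smul, smul_apply,
          map_smul, smul_smul]
        push_cast
        simp only [ha, hb, ket_eq]
        rfl
      have hr : ∑ z : {i // i ∈ s} ⊕ {i // i ∈ s} → Fin 2, (∏ i, ketR (c i) (z i)) *
          A (e z).1 (e z).2 = ∑ x, ∑ y, (∏ i : {i // i ∈ s}, ketR (a i) (x i)) *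
          (∏ i : {i // i ∈ s}, ketR (b i) (y i)) * A x y := by
        rw [← e.symm.sum_comp, Fintype.sum_prod_type]
        refine Finset.sum_congr rfl fun x _ => Finset.sum_congr rfl fun y _ => ?_
        rw [Equiv.apply_symm_apply, Fintype.prod_sum_type]
        simp only [ha, hb]
        rfl
      rw [hl, hr]
      exact hab)
  refine ⟨χ, fun x y => ?_⟩
  have := hχ (e.symm (x, y))
  simp only [Equiv.apply_symm_apply] at this
  rw [this, Complex.coe_smul]

end Register

/-! ### Gates on bipartite registers -/

section Bipartite

variable {H : Type*} [NormedAddCommGroup H] [InnerProductSpace ℂ H] {n : ℕ}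

theorem raiseOn_congr (P : Fin n → Angle → H →L[ℂ] H) {s : Finset (Fin n)} {x y : Fin n → Fin 2}
    (h : ∀ i ∈ s, x i = y i) : raiseOn P s x = raiseOn P s y :=
  prodOn_congr fun i hi => by rw [h i hi]

theorem isGround_prodOn_zero {P : Fin n → Angle → H →L[ℂ] H} (hP : PairwiseCommute P)
    {s : Finset (Fin n)} {u : H} (hg : ∀ i ∈ s, IsGround (P i) u) :
    prodOn s (fun i => P i (bitAngle 0)) u = u := by
  have h := prodOn_apply_congr (s := s) (f := fun i => P i (bitAngle 0)) (g := fun _ => 1) (ψ := u)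
    (fun i j hij => hP i j hij _ _) (fun _ _ _ => Commute.one_left _)
    (fun _ _ _ => Commute.one_right _) fun i hi => hg i hi
  rw [h]
  simp [prodOn]

/-- Two commuting algebras of operators, with the measurements of two sets of registers. -/
structure IsBipartite (S S' : Subalgebra ℂ (H →L[ℂ] H)) (P Q : Fin n → Angle → H →L[ℂ] H) :
    Prop where
  commute : ∀ M ∈ S, ∀ N ∈ S', Commute M N
  left_mem : ∀ i a, P i a ∈ S
  right_mem : ∀ i a, Q i a ∈ S'
  left_commute : PairwiseCommute P
  right_commute : PairwiseCommute Q

namespace IsBipartite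

variable {S S' : Subalgebra ℂ (H →L[ℂ] H)} {P Q : Fin n → Angle → H →L[ℂ] H}

theorem symm (h : IsBipartite S S' P Q) : IsBipartite S' S Q P where
  commute M hM N hN := (h.commute N hN M hM).symm
  left_mem := h.right_mem
  right_mem := h.left_mem
  left_commute := h.right_commute
  right_commute := h.left_commute

theorem cross_commute (h : IsBipartite S S' P Q) (i j : Fin n) (a b : Angle) :
    Commute (P i a) (Q j b) :=
  h.commute _ (h.left_mem i a) _ (h.right_mem j b)

end IsBipartite

variable [CompleteSpace H]

/-- `U` can be undone within `S`. This discards the gate of the party whose operators generate the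
orbit. -/
theorem orbit_unitary {S : Subalgebra ℂ (H →L[ℂ] H)} {U : H →L[ℂ] H} (hU : U ∈ S)
    (hU' : star U ∈ S) (hu : U ∈ unitary (H →L[ℂ] H)) (ψ : H) : orbit S (U ψ) = orbit S ψ := by
  have h1 : star U (U ψ) = ψ := DFunLike.congr_fun (Unitary.mem_iff.1 hu).1 ψ
  ext v
  constructor <;> intro hv <;> obtain ⟨M, hM, rfl⟩ := mem_orbit.1 hv
  · exact mem_orbit.2 ⟨M * U, S.mul_mem hM hU, rfl⟩
  · exact mem_orbit.2 ⟨M * star U, S.mul_mem hM hU', by rw [mul_apply_eq_comp, h1]⟩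

/-- The transposition trick: on an EPR pair |s⟩⟨0| on one side equals |0⟩⟨s| on the other. For `s =
1`, both P⁰ and X are moved across, and X exchanges the two bit projectors. -/
theorem IsEPR.raise_proj_zero {P Q : Angle → H →L[ℂ] H} {ψ : H} {L : Submodule ℂ H}
    (h : IsEPR P Q ψ) (hQ : IsQubit Q L) (hL : ψ ∈ L) (s : Fin 2) :
    raise P s (P (bitAngle 0) ψ) = lower Q s ψ := by
  fin_cases s
  · simp [raise, lower, h.proj_eq]
  · have hc : Commute (pauliX P) (Q (bitAngle 0)) :=
      (commute_observable (fun a => (h.commute a _).symm) 2).symm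
    have h2 := hQ.bit_zero_pauliX hL
    simp only [raise, lower, Fin.mk_one, pow_one, mul_apply_eq_comp]
    rw [h.proj_eq, Commute.apply_apply hc, h.observable_eq, h2]

namespace IsBipartite

variable {S S' : Subalgebra ℂ (H →L[ℂ] H)} {P Q : Fin n → Angle → H →L[ℂ] H}

variable {ψ : H}

theorem isRegister (h : IsBipartite S S' P Q) (hψ : ∀ i, IsEPR (P i) (Q i) ψ) :
    IsRegister P (orbit S' ψ) where
  qubit i := (hψ i).isQubit (fun M hM a => (h.commute _ (h.left_mem i a) M hM).symm) (h.right_mem i)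
  commute := h.left_commute

theorem prodOn_proj_eq (h : IsBipartite S S' P Q) (hψ : ∀ i, IsEPR (P i) (Q i) ψ)
    (s : Finset (Fin n)) (a : Fin n → Angle) :
    prodOn s (fun i => P i (a i)) ψ = prodOn s (fun i => Q i (a i)) ψ :=
  prodOn_apply_congr (fun i j hij => h.left_commute i j hij _ _)
    (fun i j hij => h.right_commute i j hij _ _) (fun i j _ => h.cross_commute i j _ _)
    fun i _ => (hψ i).proj_eq _

theorem raiseOn_prodOn_zero (h : IsBipartite S S' P Q) (hψ : ∀ i, IsEPR (P i) (Q i) ψ)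
    (s : Finset (Fin n)) (x : Fin n → Fin 2) :
    raiseOn P s x (prodOn s (fun i => P i (bitAngle 0)) ψ) = lowerOn Q s x ψ := by
  have hr := h.symm.isRegister fun i => (hψ i).symm
  have h1 : raiseOn P s x * prodOn s (fun i => P i (bitAngle 0)) =
      prodOn s fun i => raise (P i) (x i) * P i (bitAngle 0) :=
    prodOn_mul fun i j hij => h.left_commute.raise_proj hij _ _
  rw [← mul_apply_eq_comp, h1]
  refine prodOn_apply_congr (fun i j hij => ?_)
    (fun i j hij => h.right_commute.lower_lower hij _ _) (fun i j _ => ?_)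
    fun i _ => (hψ i).raise_proj_zero (hr.qubit i) (self_mem_orbit S ψ) (x i)
  · exact Commute.mul_left
      ((h.left_commute.raise_raise hij _ _).mul_right (h.left_commute.raise_proj hij _ _))
      ((h.left_commute.raise_proj hij.symm _ _).symm.mul_right (h.left_commute i j hij _ _))
  · exact h.commute _ (S.mul_mem (raise_mem S (h.left_mem i) _) (h.left_mem i _)) _
      (lower_mem S' (h.right_mem j) _)

/-- Each further bit halves the squared norm: X exchanges the two outcomes, and on the vector at
hand it equals the X of the other party, a unitary commuting with the projectors. -/
theorem norm_sq_prodOn_bit (h : IsBipartite S S' P Q) (hψ : ∀ i, IsEPR (P i) (Q i) ψ)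
    (s : Finset (Fin n)) (x : Fin n → Fin 2) :
    2 ^ s.card * ‖prodOn s (fun i => P i (bitAngle (x i))) ψ‖ ^ 2 = ‖ψ‖ ^ 2 := by
  have hr := h.isRegister hψ
  induction s using Finset.induction_on with
  | empty => simp
  | insert i s hi ih =>
    set M := prodOn s fun i => P i (bitAngle (x i)) with hM
    have hMP : ∀ a, Commute M (P i a) := fun a => Commute.symm <| commute_prodOn fun j hj =>
      h.left_commute i j (fun hij => hi (hij ▸ hj)) _ _
    have hMS : M ∈ S := prodOn_mem S fun i _ => h.left_mem i _
    have hMK : M ψ ∈ orbit S' ψ :=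
      prodOn_mem (stabilizer _) (fun i _ => (hr.qubit i).mem_stabilizer _) ψ (self_mem_orbit S' ψ)
    have hx : pauliX (P i) (M ψ) = pauliX (Q i) (M ψ) := by
      rw [← Commute.apply_apply (commute_observable hMP 2), (hψ i).observable_eq,
        Commute.apply_apply (commute_observable (fun a => h.commute M hMS _ (h.right_mem i a)) 2)]
    have hX : Commute (P i (bitAngle 0)) (pauliX (Q i)) :=
      commute_observable (fun a => h.cross_commute i i _ a) 2
    have heq : ‖P i (bitAngle 1) (M ψ)‖ = ‖P i (bitAngle 0) (M ψ)‖ := by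
      rw [← norm_of_mem_unitary ((hr.isMeasurement i).observable_mem_unitary 2),
        ← (hr.qubit i).bit_zero_pauliX hMK, hx, Commute.apply_apply hX,
        norm_of_mem_unitary ((hψ i).right.observable_mem_unitary 2)]
    have hsum := (hr.isMeasurement i).norm_sq_add 0 (M ψ)
    have heq' : ‖P i (0, 1) (M ψ)‖ = ‖P i (0, 0) (M ψ)‖ := heq
    have hall : ∀ t, 2 * ‖P i (bitAngle t) (M ψ)‖ ^ 2 = ‖M ψ‖ ^ 2 := fun t => by
      rw [← hsum, heq', ← two_mul]
      fin_cases t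
      · rfl
      · simp only [bitAngle, Fin.mk_one, heq']
    rw [prodOn_insert (fun i j hij => h.left_commute i j hij _ _) hi, mul_apply_eq_comp,
      Finset.card_insert_of_notMem hi, pow_succ, mul_assoc, ← hM, hall, ih]

/-- A pair of gates whose statistics on an EPR source are those of `(T ⊗ Id) |Φ⁺⟩` acts as `T`. -/
theorem gate_action (h : IsBipartite S S' P Q) (hψ : ∀ i, IsEPR (P i) (Q i) ψ)
    {U V : H →L[ℂ] H} (hU : U ∈ S) (hU' : star U ∈ S) (hUu : U ∈ unitary (H →L[ℂ] H))
    (hV : V ∈ S') (hV' : star V ∈ S') (hVu : V ∈ unitary (H →L[ℂ] H))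
    (hUVψ : ∀ i, IsEPR (P i) (Q i) (U (V ψ))) {s : Finset (Fin n)}
    (hUP : ∀ i ∉ s, ∀ a, Commute U (P i a))
    (T : Matrix ({i // i ∈ s} → Fin 2) ({i // i ∈ s} → Fin 2) ℝ) (hT : T * T.transpose = 1)
    {c : ℝ} (hc : c ≠ 0) (d : Fin n → Fin 2)
    (htom : ∀ a b : Fin n → Angle,
      ‖prodOn s (fun i => P i (a i)) (prodOn s (fun i => Q i (b i)) (U ψ))‖ ^ 2 =
        (∑ x, ∑ y, (∏ i : {i // i ∈ s}, ketR (a i) (x i)) *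
          (∏ i : {i // i ∈ s}, ketR (b i) (y i)) * (T x y * c)) ^ 2)
    {u : H} (hu : u ∈ orbit S' ψ) (hg : ∀ i, IsGround (P i) u) :
    ∃ u' ∈ orbit S' (U (V ψ)), (∀ i, IsGround (P i) u') ∧ ‖u'‖ = ‖u‖ ∧
      ∀ x, U (raiseOn P s (extendBy s d x) u) =
        ∑ y, (T y x : ℂ) • raiseOn P s (extendBy s d y) u' := by
  have hsource := h.isRegister hψ
  -- Here the EPR statistics after both gates enter: `V` does not change the orbit under `S'`, so
  -- the measurements `P` are still those of qubits around `U ψ`.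
  have hA : IsRegister P (orbit S' (U ψ)) := by
    have := h.isRegister hUVψ
    rwa [Commute.apply_apply (h.commute U hU V hV), orbit_unitary hV hV' hVu] at this
  -- For `Q` the statistics of the source suffice, since `U` does not change the orbit under `S`.
  have hB : IsRegister Q (orbit S (U ψ)) := by
    rw [orbit_unitary hU hU' hUu]
    exact h.symm.isRegister fun i => (hψ i).symm
  obtain ⟨χ, hχ⟩ := register_tomography hA hB (self_mem_orbit _ _) (self_mem_orbit _ _)
    h.cross_commute (fun i a v hv => apply_mem_orbit (h.right_mem i a) hv)
    (fun i a v hv => apply_mem_orbit (h.left_mem i a) hv) s d (fun x y => T x y * c) htom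
  have hlow : ∀ x y, lowerOn P s x (lowerOn Q s y (U ψ)) ∈ orbit S' (U ψ) ∧
      ∀ i ∈ s, IsGround (P i) (lowerOn P s x (lowerOn Q s y (U ψ))) := fun x y => by
    have hm : lowerOn Q s y (U ψ) ∈ orbit S' (U ψ) :=
      apply_mem_orbit (prodOn_mem S' fun i _ => lower_mem S' (h.right_mem i) _)
        (self_mem_orbit _ _)
    exact ⟨hA.lowerOn_mem s x hm, fun i hi => hA.isGround_lowerOn x hm hi⟩
  have hrow : ∀ x, ∑ y, T x y ^ 2 = 1 := fun x => by
    have := congrFun (congrFun hT x) x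
    simpa [Matrix.mul_apply, sq] using this
  have hχK : χ ∈ orbit S' (U ψ) ∧ ∀ i ∈ s, IsGround (P i) χ := by
    -- A row of an orthogonal matrix has a nonzero entry, so χ is a multiple of one of the lowered
    -- vectors and inherits their properties.
    obtain ⟨y, -, hy⟩ := Finset.exists_ne_zero_of_sum_ne_zero
      (show ∑ y, T (fun _ => 0) y ^ 2 ≠ 0 by rw [hrow]; exact one_ne_zero)
    have hne : ((T (fun _ => 0) y * c : ℝ) : ℂ) ≠ 0 :=
      Complex.ofReal_ne_zero.2 (mul_ne_zero (fun h0 => hy (by rw [h0]; ring)) hc)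
    have hχ' : χ = ((T (fun _ => 0) y * c : ℝ) : ℂ)⁻¹ •
        lowerOn P s (extendBy s d fun _ => 0) (lowerOn Q s (extendBy s d y) (U ψ)) := by
      rw [hχ, smul_smul, inv_mul_cancel₀ hne, one_smul]
    rw [hχ']
    exact ⟨Submodule.smul_mem _ _ (hlow _ _).1, fun i hi => ((hlow _ _).2 i hi).smul _⟩
  obtain ⟨M, hM, rfl⟩ := mem_orbit.1 hu
  have hMP : ∀ i a, Commute M (P i a) := fun i a => (h.commute _ (h.left_mem i a) M hM).symm
  -- The new junk vector; it does not depend on the input string.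
  set u' := (c : ℂ) • M χ with hu'
  have hraise : ∀ x, raiseOn P s x ∈ S := fun x =>
    prodOn_mem S fun i _ => raise_mem S (h.left_mem i) _
  have hact : ∀ x, U (raiseOn P s (extendBy s d x) (M ψ)) =
      ∑ y, (T y x : ℂ) • raiseOn P s (extendBy s d y) u' := by
    intro x
    have hproj : (prodOn s fun i => P i (bitAngle 0)) ∈ S := prodOn_mem S fun i _ => h.left_mem i _
    have hlowS : ∀ z, lowerOn Q s z ∈ S' := fun z =>
      prodOn_mem S' fun i _ => lower_mem S' (h.right_mem i) _
    -- As `M ψ` is ground, the projectors at angle 0 can be inserted; together with `raiseOn` they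
    -- turn into a bra of the other party, and `U` commutes with that.
    have e1 : U (raiseOn P s (extendBy s d x) (M ψ)) =
        M (lowerOn Q s (extendBy s d x) (U ψ)) := by
      conv_lhs => rw [← isGround_prodOn_zero h.left_commute (s := s) fun i _ => hg i]
      rw [Commute.apply_apply (h.commute _ hproj M hM),
        Commute.apply_apply (h.commute _ (hraise _) M hM), h.raiseOn_prodOn_zero hψ,
        Commute.apply_apply (h.commute U hU M hM), Commute.apply_apply (h.commute U hU _ (hlowS _))]
    have e2 := DFunLike.congr_fun (sum_raiseOn_mul_lowerOn h.left_commute hA.isMeasurement s d)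
      (lowerOn Q s (extendBy s d x) (U ψ))
    rw [e1, ← one_apply_eq_self (F := H →L[ℂ] H) (lowerOn Q s (extendBy s d x) (U ψ)), ← e2,
      sum_apply, map_sum]
    refine Finset.sum_congr rfl fun y _ => ?_
    rw [mul_apply_eq_comp, hχ, map_smul, map_smul,
      ← Commute.apply_apply (h.commute _ (hraise _) M hM), hu', map_smul, smul_smul]
    push_cast
    rfl
  have hu'K : u' ∈ orbit S' (U ψ) := Submodule.smul_mem _ _ (apply_mem_orbit hM hχK.1)
  have hu's : ∀ i ∈ s, IsGround (P i) u' := fun i hi =>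
    ((hχK.2 i hi).of_commute (hMP i _)).smul _
  have hone : raiseOn P s (extendBy s d fun _ => 0) = 1 := by
    rw [raiseOn, prodOn_congr (g := fun _ => 1) fun i hi => by
      rw [extendBy_of_mem hi]; simp [raise]]
    simp [prodOn]
  -- Row 0 of T Tᵀ = 1 recovers `u'` from the images of the basis states, from which its norm and
  -- its behaviour outside `s` are read off.
  have hinv : u' = ∑ x, (T (fun _ => 0) x : ℂ) • U (raiseOn P s (extendBy s d x) (M ψ)) := by
    simp only [hact, Finset.smul_sum, smul_smul]
    rw [Finset.sum_comm]
    have horth : ∀ y, ∑ x, (T (fun _ => 0) x : ℂ) * (T y x : ℂ) =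
        if (fun _ => 0) = y then 1 else 0 := fun y => by
      have := congrFun (congrFun hT fun _ => 0) y
      rw [Matrix.mul_apply, Matrix.one_apply] at this
      simp only [Matrix.transpose_apply] at this
      have := congrArg Complex.ofReal this
      push_cast at this
      rw [this]
      split_ifs <;> simp
    simp only [← Finset.sum_smul, horth, ite_smul, one_smul, zero_smul, Finset.sum_ite_eq,
      Finset.mem_univ, if_true, hone, one_apply_eq_self]
  refine ⟨u', ?_, fun i => ?_, ?_, hact⟩
  · rwa [Commute.apply_apply (h.commute U hU V hV), orbit_unitary hV hV' hVu]
  · by_cases hi : i ∈ s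
    · exact hu's i hi
    -- Outside `s` both `U` and `raiseOn` over `s` commute with the measurement, so every summand of
    -- `hinv` stays ground.
    · have hterm : ∀ x, IsGround (P i) (U (raiseOn P s (extendBy s d x) (M ψ))) := fun x =>
        ((hg i).of_commute <| Commute.symm <| commute_prodOn fun j hj =>
          (h.left_commute.raise_proj (fun hji : j = i => hi (hji ▸ hj)) _ _).symm).of_commute
          (hUP i hi _)
      simp only [IsGround] at hterm
      rw [IsGround, hinv]
      simp only [map_sum, map_smul, hterm]
  · have hn := hsource.norm_sq_sum_raiseOn (s := s) d hu (fun i _ => hg i) (T fun _ => 0)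
    rw [hrow, one_mul, ← norm_of_mem_unitary hUu, map_sum] at hn
    simp only [map_smul] at hn
    rw [← hinv] at hn
    exact (sq_eq_sq₀ (norm_nonneg _) (norm_nonneg _)).1 hn

end IsBipartite

end Bipartite

/-! ### Ideal amplitudes -/

theorem inner_maxEntangled (a b : Angle) :
    ‖⟪tensorKet (ket a) (ket b), maxEntangled (Fin 2)⟫_ℂ‖ ^ 2 =
      Real.cos (a.val - b.val) ^ 2 / 2 := by
  have h : ⟪tensorKet (ket a) (ket b), maxEntangled (Fin 2)⟫_ℂ =
      ((Real.cos (a.val - b.val) * (√2)⁻¹ : ℝ) : ℂ) := by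
    rw [PiLp.inner_apply, Fintype.sum_prod_type, Real.cos_sub]
    simp only [Fin.sum_univ_two, tensorKet, maxEntangled, ket, RCLike.inner_apply, map_mul]
    simp [-Complex.ofReal_cos, -Complex.ofReal_sin,
      Complex.conj_ofReal]
    ring
  rw [h, Complex.norm_real, Real.norm_eq_abs, sq_abs, mul_pow, inv_pow, Real.sq_sqrt (by norm_num)]
  rfl

theorem kets_apply {κ : Type*} [Fintype κ] (a : κ → Angle) (x : κ → Fin 2) :
    kets a x = ((∏ i, ketR (a i) (x i) : ℝ) : ℂ) := by
  simp [kets, ket_eq]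

variable {n : ℕ} {α β : Fin n → Type*}

/-- `T` as a real matrix on the qubits of its support. -/
abbrev Gate.idealR (g : Gate α β) :
    Matrix ({i // i ∈ g.support} → Fin 2) ({i // i ∈ g.support} → Fin 2) ℝ := g.ideal

theorem idealOutput_apply (g : Gate α β) (x y : {i // i ∈ g.support} → Fin 2) :
    g.idealOutput (x, y) = ((g.idealR x y *
      (√(Fintype.card ({i // i ∈ g.support} → Fin 2)))⁻¹ : ℝ) : ℂ) := by
  simp only [Gate.idealOutput, applyMat, maxEntangled, Matrix.mulVec, dotProduct]
  rw [Fintype.sum_prod_type]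
  simp only [Matrix.kroneckerMap_apply, Matrix.one_apply, Gate.idealC, Matrix.map_apply]
  rw [Finset.sum_eq_single y, Finset.sum_eq_single y]
  · simp
  · intro z _ hz
    simp [hz.symm]
  · simp
  · intro z _ hz
    refine Finset.sum_eq_zero fun z' _ => ?_
    by_cases h : y = z'
    · subst h; simp [hz]
    · simp [h]
  · simp

theorem inner_idealOutput (g : Gate α β) (a b : {i // i ∈ g.support} → Angle) :
    ‖⟪tensorKet (kets a) (kets b), g.idealOutput⟫_ℂ‖ ^ 2 =
      (∑ x, ∑ y, (∏ i, ketR (a i) (x i)) * (∏ i, ketR (b i) (y i)) *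
        (g.idealR x y *
          (√(Fintype.card ({i // i ∈ g.support} → Fin 2)))⁻¹)) ^ 2 := by
  have h : ⟪tensorKet (kets a) (kets b), g.idealOutput⟫_ℂ =
      ((∑ x, ∑ y, (∏ i, ketR (a i) (x i)) * (∏ i, ketR (b i) (y i)) *
        (g.idealR x y *
          (√(Fintype.card ({i // i ∈ g.support} → Fin 2)))⁻¹) : ℝ) : ℂ) := by
    rw [PiLp.inner_apply, Fintype.sum_prod_type]
    push_cast
    refine Finset.sum_congr rfl fun x _ => Finset.sum_congr rfl fun y _ => ?_
    rw [idealOutput_apply]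
    simp only [tensorKet, kets_apply, RCLike.inner_apply, map_mul, Complex.conj_ofReal]
    push_cast
    ring
  rw [h, Complex.norm_real, Real.norm_eq_abs, sq_abs]

/-! ### The physical registers -/

section Physical

/-- The operators on `A`. -/
def leftOps (X Y : Type*) : Subalgebra ℂ (Op (X × Y)) :=
  ((ampHom (Equiv.refl (X × Y))).toAlgHom : Op X →ₐ[ℂ] Op (X × Y)).range

/-- The operators on `B`. -/
def rightOps (X Y : Type*) : Subalgebra ℂ (Op (X × Y)) :=
  ((ampHom (Equiv.prodComm X Y)).toAlgHom : Op Y →ₐ[ℂ] Op (X × Y)).range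

theorem onA_mem {X Y : Type*} (M : Op X) : onA M ∈ leftOps X Y := ⟨M, rfl⟩

theorem onB_mem {X Y : Type*} (M : Op Y) : onB M ∈ rightOps X Y := ⟨M, rfl⟩

theorem star_onA {X Y : Type*} (M : Op X) : star (onA M : Op (X × Y)) = onA (star M) :=
  (amp_star _ _).symm

theorem star_onB {X Y : Type*} (M : Op Y) : star (onB M : Op (X × Y)) = onB (star M) :=
  (amp_star _ _).symm

theorem amp_mem_unitary {X Y Z : Type*} (e : X ≃ Y × Z) {M : Op Y} (hM : M ∈ unitary (Op Y)) :
    amp e M ∈ unitary (Op X) :=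
  Unitary.map_mem (ampHom e) hM

theorem isStarProjection_amp {X Y Z : Type*} (e : X ≃ Y × Z) {M : Op Y} (hM : IsStarProjection M) :
    IsStarProjection (amp e M) :=
  hM.map (ampHom e)

theorem commute_amp_of_commute {X Y Z : Type*} (e : X ≃ Y × Z) {M N : Op Y} (h : Commute M N) :
    Commute (amp e M) (amp e N) :=
  h.map (ampHom e)

/-- The measurement on the register `A^i`, extended by the identity to `A ⊗ B`. -/
def regA (β : Fin n → Type*) (PA : ∀ i, Measurements (α i)) (i : Fin n) (a : Angle) :
    Op ((∀ i, α i) × (∀ i, β i)) := onA (onReg i ((PA i).proj a))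

/-- The measurement on the register `B^i`, extended by the identity to `A ⊗ B`. -/
def regB (α : Fin n → Type*) (PB : ∀ i, Measurements (β i)) (i : Fin n) (a : Angle) :
    Op ((∀ i, α i) × (∀ i, β i)) := onB (onReg i ((PB i).proj a))

variable (PA : ∀ i, Measurements (α i)) (PB : ∀ i, Measurements (β i))

theorem isMeasurement_regA (i : Fin n) : IsMeasurement (regA β PA i) where
  isStarProjection a := isStarProjection_amp _ (isStarProjection_amp _ ((PA i).isStarProjection a))
  add_eq_one k := by
    have h : ∀ a, regA β PA i a = ampHom (Equiv.refl _) (ampHom (Equiv.piSplitAt i α)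
      ((PA i).proj a)) := fun _ => rfl
    rw [h, h, ← map_add, ← map_add, (PA i).add_eq_one, map_one, map_one]

theorem isMeasurement_regB (i : Fin n) : IsMeasurement (regB α PB i) where
  isStarProjection a := isStarProjection_amp _ (isStarProjection_amp _ ((PB i).isStarProjection a))
  add_eq_one k := by
    have h : ∀ a, regB α PB i a = ampHom (Equiv.prodComm _ _) (ampHom (Equiv.piSplitAt i β)
      ((PB i).proj a)) := fun _ => rfl
    rw [h, h, ← map_add, ← map_add, (PB i).add_eq_one, map_one, map_one]

theorem isBipartite : IsBipartite (leftOps _ _) (rightOps _ _) (regA β PA) (regB α PB) where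
  commute := by
    rintro _ ⟨M, rfl⟩ _ ⟨N, rfl⟩
    exact commute_onA_onB M N
  left_mem _ _ := onA_mem _
  right_mem _ _ := onB_mem _
  left_commute _ _ hij _ _ := commute_amp_of_commute _ (commute_onReg hij _ _)
  right_commute _ _ hij _ _ := commute_amp_of_commute _ (commute_onReg hij _ _)

theorem projAll_eq (a : Fin n → Angle) :
    projAll PA a = prodOn Finset.univ fun i => onReg i ((PA i).proj (a i)) := by
  rw [prodOn_univ]; rfl

theorem projOn_eq (I : Finset (Fin n)) (a : Fin n → Angle) :
    projOn PA I (fun i => a i) = prodOn I fun i => onReg i ((PA i).proj (a i)) := by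
  rw [projOn, tensorOp, prodOn]
  congr 2
  funext i
  split_ifs
  · rfl
  · exact amp_one _

theorem onA_prodOn (s : Finset (Fin n)) (f : Fin n → Op (∀ i, α i)) :
    (onA (prodOn s f) : Op ((∀ i, α i) × (∀ i, β i))) = prodOn s fun i => onA (f i) :=
  map_prodOn (ampHom (Equiv.refl _)) s f

theorem onB_prodOn (s : Finset (Fin n)) (f : Fin n → Op (∀ i, β i)) :
    (onB (prodOn s f) : Op ((∀ i, α i) × (∀ i, β i))) = prodOn s fun i => onB (f i) :=
  map_prodOn (ampHom (Equiv.prodComm _ _)) s f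

theorem isStarProjection_projAll (a : Fin n → Angle) : IsStarProjection (projAll PA a) := by
  rw [projAll_eq]
  have h : ∀ s : Finset (Fin n),
      IsStarProjection (prodOn s fun i => onReg i ((PA i).proj (a i))) := by
    intro s
    induction s using Finset.induction_on with
    | empty => simp
    | insert i s hi ih =>
      rw [prodOn_insert (fun i j hij => commute_onReg hij _ _) hi]
      exact (isStarProjection_amp _ ((PA i).isStarProjection _)).mul ih <|
        commute_prodOn fun j hj => commute_onReg (fun hij : i = j => hi (hij ▸ hj)) _ _
  exact h _

theorem isEPR_iff (i : Fin n) (ψ : L2 ((∀ i, α i) × (∀ i, β i))) :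
    IsEPR (regA β PA i) (regB α PB i) ψ ↔
      Simulates (pairProj PA PB i) (fun ab => tensorKet (ket ab.1) (ket ab.2)) ψ
        (maxEntangled (Fin 2)) := by
  constructor
  · rintro h ⟨a, b⟩
    rw [inner_maxEntangled]
    exact h.correlation a b
  · intro h
    refine ⟨isMeasurement_regA PA i, isMeasurement_regB PB i,
      (isBipartite PA PB).cross_commute i i, fun a b => ?_⟩
    rw [← inner_maxEntangled]
    exact h (a, b)

namespace Gate

variable (g : Gate α β)

theorem extA_mem_unitary : g.extA ∈ unitary (Op (∀ i, α i)) := amp_mem_unitary _ g.opA.2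

theorem extB_mem_unitary : g.extB ∈ unitary (Op (∀ i, β i)) := amp_mem_unitary _ g.opB.2

theorem commute_onA_extA {i : Fin n} (hi : i ∉ g.support) (a : Angle) :
    Commute (onA g.extA) (regA β PA i a) :=
  commute_amp_of_commute _ (commute_onReg_onSubset hi _ _).symm

theorem commute_onB_extB {i : Fin n} (hi : i ∉ g.support) (a : Angle) :
    Commute (onB g.extB) (regB α PB i a) :=
  commute_amp_of_commute _ (commute_onReg_onSubset hi _ _).symm

theorem extIdeal_extendBy (x : Fin n → Fin 2) (y : {i // i ∈ g.support} → Fin 2) :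
    g.extIdeal (extendBy g.support x y) x =
      ((g.idealR y fun i => x i : ℝ) : ℂ) := by
  rw [extIdeal, Matrix.of_apply, if_pos fun i hi => extendBy_of_notMem hi]
  have : (fun i : {i // i ∈ g.support} => extendBy g.support x y i) = y :=
    funext fun i => extendBy_of_mem i.2
  rw [this]
  rfl

theorem extIdeal_eq_zero {x y : Fin n → Fin 2}
    (h : y ∉ Set.range (extendBy g.support x)) : g.extIdeal y x = 0 := by
  rw [extIdeal, Matrix.of_apply, if_neg]
  intro hxy
  refine h ⟨fun i => y i, funext fun i => ?_⟩
  by_cases hi : i ∈ g.support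
  · rw [extendBy_of_mem hi]
  · rw [extendBy_of_notMem hi, hxy i hi]

end Gate

end Physical

/-! ### Circuits -/

section Circuit

variable {n : ℕ} {α β : Fin n → Type*} (PA : ∀ i, Measurements (α i)) (PB : ∀ i, Measurements (β i))

theorem compose_zero {M : Type*} [Monoid M] (f : Fin 0 → M) : compose f = 1 := by simp [compose]

theorem compose_succ {M : Type*} [Monoid M] {t : ℕ} (f : Fin (t + 1) → M) :
    compose f = compose (fun j => f j.succ) * f 0 := by
  simp [compose, List.ofFn_succ]

theorem stateAt_succ {t : ℕ} (g : Fin t → Gate α β) (Ψ : L2 ((∀ i, α i) × (∀ i, β i)))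
    (j : Fin t) :
    stateAt g Ψ j.succ = onA (g j).extA (onB (g j).extB (stateAt g Ψ j.castSucc)) :=
  Fin.induction_succ _ _ _

theorem stateAt_succ_eq {t : ℕ} (g : Fin (t + 1) → Gate α β) (Ψ : L2 ((∀ i, α i) × (∀ i, β i)))
    (j : Fin (t + 1)) :
    stateAt g Ψ j.succ =
      stateAt (fun j => g j.succ) (onA (g 0).extA (onB (g 0).extB Ψ)) j := by
  induction j using Fin.induction with
  | zero => rw [stateAt_succ]; rfl
  | succ j ih => rw [stateAt_succ, stateAt_succ, ← Fin.succ_castSucc, ih]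

variable {PA PB}

/-- Condition 2 tests only the registers on which a gate acts. On the others the gates commute with
the measurements and preserve norms. -/
theorem isEPR_gate (g : Gate α β) {Ψ : L2 ((∀ i, α i) × (∀ i, β i))} {i : Fin n}
    (hi : i ∉ g.support) (h : IsEPR (regA β PA i) (regB α PB i) Ψ) :
    IsEPR (regA β PA i) (regB α PB i) (onA g.extA (onB g.extB Ψ)) where
  left := h.left
  right := h.right
  commute := h.commute
  correlation a b := by
    have h1 : Commute (onA g.extA) (regB α PB i b) := commute_onA_onB _ _
    have h2 : Commute (regA β PA i a) (onB g.extB) := commute_onA_onB _ _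
    rw [← Commute.apply_apply h1, ← Commute.apply_apply (g.commute_onB_extB PB hi b),
      ← Commute.apply_apply (g.commute_onA_extA PA hi a), Commute.apply_apply h2,
      norm_of_mem_unitary (U := onA g.extA) (amp_mem_unitary _ g.extA_mem_unitary),
      norm_of_mem_unitary (U := onB g.extB) (amp_mem_unitary _ g.extB_mem_unitary), h.correlation]

namespace SimulationConditions

/-- The induction step along the circuit: after the first gate pair the state serves as the source
for the remaining gates. -/
theorem tail {t : ℕ} {g : Fin (t + 1) → Gate α β} {Ψ : L2 ((∀ i, α i) × (∀ i, β i))}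
    (h : SimulationConditions PA PB g Ψ) :
    SimulationConditions PA PB (fun j => g j.succ) (onA (g 0).extA (onB (g 0).extB Ψ)) where
  source i := by
    rw [← isEPR_iff]
    by_cases hi : i ∈ (g 0).support
    · rw [isEPR_iff]
      exact h.conspiracy 0 i hi
    · exact isEPR_gate _ hi ((isEPR_iff PA PB i Ψ).2 (h.source i))
  conspiracy j i hi := by
    rw [← stateAt_succ_eq]
    exact h.conspiracy j.succ i hi
  tomography j := by
    have := h.tomography j.succ
    rw [halfStateAt, ← Fin.succ_castSucc, stateAt_succ_eq] at this
    exact this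

end SimulationConditions

theorem tomography_statistics {g : Gate α β} {ψ : L2 ((∀ i, α i) × (∀ i, β i))}
    (h : Simulates (subsetProj PA PB g.support)
      (fun ab => tensorKet (kets ab.1) (kets ab.2)) ψ g.idealOutput) (a b : Fin n → Angle) :
    ‖prodOn g.support (fun i => regA β PA i (a i))
      (prodOn g.support (fun i => regB α PB i (b i)) ψ)‖ ^ 2 =
      (∑ x, ∑ y, (∏ i : {i // i ∈ g.support}, ketR (a i) (x i)) *
        (∏ i : {i // i ∈ g.support}, ketR (b i) (y i)) * (g.idealR x y *
          (√(Fintype.card ({i // i ∈ g.support} → Fin 2)))⁻¹)) ^ 2 := by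
  have := h (fun i => a i, fun i => b i)
  rw [inner_idealOutput, subsetProj, projOn_eq, projOn_eq, onA_prodOn, onB_prodOn] at this
  exact this

/-- Spectator registers are factored out: `raiseOn` over the complement of the support commutes with
the gate. -/
theorem gate_action_all {g : Gate α β} {Ψ : L2 ((∀ i, α i) × (∀ i, β i))}
    (hΨ : ∀ i, IsEPR (regA β PA i) (regB α PB i) Ψ)
    (hgΨ : ∀ i, IsEPR (regA β PA i) (regB α PB i) (onA g.extA (onB g.extB Ψ)))
    (htom : Simulates (subsetProj PA PB g.support)
      (fun ab => tensorKet (kets ab.1) (kets ab.2)) (onA g.extA Ψ) g.idealOutput)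
    {u : L2 ((∀ i, α i) × (∀ i, β i))} (hu : u ∈ orbit (rightOps _ _) Ψ)
    (hg : ∀ i, IsGround (regA β PA i) u) :
    ∃ u' ∈ orbit (rightOps _ _) (onA g.extA (onB g.extB Ψ)), (∀ i, IsGround (regA β PA i) u') ∧
      ‖u'‖ = ‖u‖ ∧ ∀ x, onA g.extA (raiseOn (regA β PA) Finset.univ x u) =
        ∑ y, g.extIdeal y x • raiseOn (regA β PA) Finset.univ y u' := by
  classical
  have hb := isBipartite PA PB
  have hc : (√(Fintype.card ({i // i ∈ g.support} → Fin 2)))⁻¹ ≠ 0 :=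
    inv_ne_zero (Real.sqrt_ne_zero'.2 (by exact_mod_cast Fintype.card_pos))
  obtain ⟨u', hu', hg', hn, hact⟩ := hb.gate_action hΨ (onA_mem g.extA)
    (by rw [star_onA]; exact onA_mem _) (amp_mem_unitary _ g.extA_mem_unitary) (onB_mem g.extB)
    (by rw [star_onB]; exact onB_mem _) (amp_mem_unitary _ g.extB_mem_unitary) hgΨ
    (fun i hi a => g.commute_onA_extA PA hi a) g.idealR
    ((Matrix.mem_orthogonalGroup_iff _ _).1 g.ideal.2) hc 0
    (tomography_statistics htom) hu hg
  refine ⟨u', hu', hg', hn, fun x => ?_⟩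
  have hsplit : ∀ y, raiseOn (regA β PA) Finset.univ y =
      raiseOn (regA β PA) g.supportᶜ y * raiseOn (regA β PA) g.support y := fun y => by
    rw [raiseOn, ← Finset.union_compl g.support, Finset.union_comm,
      prodOn_union (fun i j hij => hb.left_commute.raise_raise hij _ _) disjoint_compl_left]
    rfl
  have hcomm : Commute (onA g.extA) (raiseOn (regA β PA) g.supportᶜ x) :=
    commute_prodOn fun i hi =>
      commute_raise (fun a => g.commute_onA_extA PA (Finset.mem_compl.1 hi) a) _
  -- The default string 0 given to `gate_action` is immaterial, because `raiseOn` over the support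
  -- never reads it.
  have hx : raiseOn (regA β PA) g.support x =
      raiseOn (regA β PA) g.support (extendBy g.support 0 fun i => x i) :=
    raiseOn_congr _ fun i hi => by rw [extendBy_of_mem hi]
  rw [hsplit, mul_apply_eq_comp, Commute.apply_apply hcomm, hx, hact, map_sum]
  -- Column `x` of the extended matrix is supported on the strings that agree with `x` off the
  -- support.
  refine Fintype.sum_of_injective (extendBy g.support x) ?_ _ _ ?_ ?_
  · intro y z hyz
    funext i
    have := congrFun hyz i
    rwa [extendBy_of_mem i.2, extendBy_of_mem i.2] at this
  · intro y hy
    rw [g.extIdeal_eq_zero hy, zero_smul]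
  · intro y
    rw [g.extIdeal_extendBy, map_smul, hsplit, mul_apply_eq_comp,
      raiseOn_congr _ (s := g.supportᶜ) (x := extendBy g.support x y) (y := x) fun i hi =>
        extendBy_of_notMem (Finset.mem_compl.1 hi),
      raiseOn_congr _ (s := g.support) (x := extendBy g.support x y)
        (y := extendBy g.support 0 y) fun i hi => by
          rw [extendBy_of_mem hi, extendBy_of_mem hi]]

/-- The source advances by both gates of each pair, so as to remain an EPR source, while the ground
vector feels only the gates on A. It stays in the orbit of the current source under the operators on
B, and this lets the gate actions compose. -/
theorem circuit_action {t : ℕ} (g : Fin t → Gate α β) (Ψ : L2 ((∀ i, α i) × (∀ i, β i)))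
    (h : SimulationConditions PA PB g Ψ) {u : L2 ((∀ i, α i) × (∀ i, β i))}
    (hu : u ∈ orbit (rightOps _ _) Ψ) (hg : ∀ i, IsGround (regA β PA i) u) :
    ∃ K : Submodule ℂ (L2 ((∀ i, α i) × (∀ i, β i))), IsRegister (regA β PA) K ∧
      ∃ u' ∈ K, (∀ i, IsGround (regA β PA i) u') ∧ ‖u'‖ = ‖u‖ ∧
        ∀ x, onA (compose fun j => (g j).extA) (raiseOn (regA β PA) Finset.univ x u) =
          ∑ y, (compose fun j => (g j).extIdeal) y x • raiseOn (regA β PA) Finset.univ y u' := by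
  classical
  have hsrc : ∀ i, IsEPR (regA β PA i) (regB α PB i) Ψ := fun i =>
    (isEPR_iff PA PB i Ψ).2 (h.source i)
  induction t generalizing Ψ u with
  | zero =>
    refine ⟨_, (isBipartite PA PB).isRegister hsrc, u, hu, hg, rfl, fun x => ?_⟩
    rw [compose_zero, compose_zero]
    simp [onA, amp_one, Matrix.one_apply]
  | succ t ih =>
    have htail : ∀ i, IsEPR (regA β PA i) (regB α PB i) (onA (g 0).extA (onB (g 0).extB Ψ)) :=
      fun i => (isEPR_iff PA PB i _).2 (h.tail.source i)
    obtain ⟨v, hv, hvg, hvn, hvact⟩ := gate_action_all hsrc htail (h.tomography 0) hu hg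
    obtain ⟨K, hK, u', hu', hg', hn, hact⟩ := ih (fun j => g j.succ) _ h.tail hv hvg htail
    refine ⟨K, hK, u', hu', hg', hn.trans hvn, fun x => ?_⟩
    have hmul : ∀ M N : Op (∀ i, α i),
        (onA (M * N) : Op ((∀ i, α i) × (∀ i, β i))) = onA M * onA N := amp_mul _
    rw [compose_succ, compose_succ (fun j => (g j).extIdeal), hmul, mul_apply_eq_comp, hvact,
      map_sum]
    simp only [map_smul, hact, Finset.smul_sum, smul_smul]
    rw [Finset.sum_comm]
    refine Finset.sum_congr rfl fun y _ => ?_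
    rw [← Finset.sum_smul, Matrix.mul_apply]
    congr 1
    exact Finset.sum_congr rfl fun z _ => mul_comm _ _

/-! ### Simulation of the output -/

/-- Measuring `x` on B steers A: P_B^x Ψ = P_A^x Ψ, which is `raiseOn` of the ground vector
`lowerOn` of Ψ. The output is thus ∑_y T_yx |y⟩ ⊗ junk, and its outcome amplitudes are the ideal
ones times the norm of the junk. -/
theorem mixedSimulates_of_action {Ψ : L2 ((∀ i, α i) × (∀ i, β i))} (hnorm : ‖Ψ‖ = 1)
    (hΨ : ∀ i, IsEPR (regA β PA i) (regB α PB i) Ψ) (x : Fin n → Fin 2) (G : Op (∀ i, α i))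
    (T : Matrix (Fin n → Fin 2) (Fin n → Fin 2) ℂ)
    {K : Submodule ℂ (L2 ((∀ i, α i) × (∀ i, β i)))} (hK : IsRegister (regA β PA) K)
    {u : L2 ((∀ i, α i) × (∀ i, β i))} (hu : u ∈ K) (hg : ∀ i, IsGround (regA β PA i) u)
    (hn : ‖u‖ = ‖lowerOn (regA β PA) Finset.univ x Ψ‖)
    (hact : onA G (raiseOn (regA β PA) Finset.univ x (lowerOn (regA β PA) Finset.univ x Ψ)) =
      ∑ y, T y x • raiseOn (regA β PA) Finset.univ y u) (v : EuclideanSpace ℂ (Fin n → Fin 2))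
    (hv : ∀ y, v y = T y x) :
    MixedSimulates (projAll PA) kets (G * inputState PB Ψ x * star G) v := by
  classical
  intro w
  have hb := isBipartite PA PB
  have hlift : raiseOn (regA β PA) Finset.univ x (lowerOn (regA β PA) Finset.univ x Ψ) =
      prodOn Finset.univ (fun i => regA β PA i (bitAngle (x i))) Ψ := by
    rw [← mul_apply_eq_comp, raiseOn, lowerOn,
      prodOn_mul fun i j hij => hb.left_commute.raise_lower hij _ _]
    simp only [(isMeasurement_regA PA _).raise_mul_lower]
  -- Each string `x` has probability 2^(-n), which the factor √(2^n) in the input state compensates.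
  have hnu : 2 ^ n * ‖u‖ ^ 2 = 1 := by
    have := hb.norm_sq_prodOn_bit hΨ Finset.univ x
    rw [← hlift, norm_of_mem_unitary (raiseOn_mem_unitary (isMeasurement_regA PA) _ _), ← hn,
      hnorm, Finset.card_univ, Fintype.card_fin, one_pow] at this
    exact this
  have hin : onB (projAll PB fun i => bitAngle (x i)) Ψ =
      raiseOn (regA β PA) Finset.univ x (lowerOn (regA β PA) Finset.univ x Ψ) := by
    rw [hlift, hb.prodOn_proj_eq hΨ, projAll_eq, onB_prodOn]
    rfl
  set ξ := ((√((2 : ℝ) ^ n) : ℝ) : ℂ) • onB (projAll PB fun i => bitAngle (x i)) Ψ with hξ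
  have hρ : G * inputState PB Ψ x * star G = reducedState (onA G ξ) := (reducedState_onA G ξ).symm
  -- All basis terms are projected to the same vector, so their coefficients add up to the ideal
  -- amplitude.
  have hout : onA (projAll PA w) (onA G ξ) =
      (((√((2 : ℝ) ^ n) : ℝ) : ℂ) * ∑ y, (∏ i, ket (w i) (y i)) * T y x) •
        prodOn Finset.univ (fun i => ketOp (regA β PA i) (w i)) u := by
    rw [hξ, hin, map_smul, hact, map_smul, projAll_eq, onA_prodOn, map_sum, mul_smul,
      Finset.sum_smul]
    congr 1
    refine Finset.sum_congr rfl fun y _ => ?_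
    have := hK.prodOn_proj_raiseOn Finset.univ w y hu fun i _ => hg i
    rw [map_smul, mul_comm, mul_smul, ← this]
    rfl
  have hinner : ⟪kets w, v⟫_ℂ = ∑ y, (∏ i, ket (w i) (y i)) * T y x := by
    rw [PiLp.inner_apply]
    refine Finset.sum_congr rfl fun y _ => ?_
    rw [RCLike.inner_apply, kets_apply, Complex.conj_ofReal, hv, mul_comm]
    simp only [ket_eq, Complex.ofReal_prod]
  have hproj := isStarProjection_amp (Equiv.refl ((∀ i, α i) × (∀ i, β i)))
    (isStarProjection_projAll PA w)
  have hreal : ∀ r : ℝ, (√((2 : ℝ) ^ n) * r * ‖u‖) ^ 2 = r ^ 2 := fun r => by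
    rw [mul_pow, mul_pow, Real.sq_sqrt (by positivity), mul_right_comm, hnu, one_mul]
  have hval : ⟪onA G ξ, onA (projAll PA w) (onA G ξ)⟫_ℂ = ((‖⟪kets w, v⟫_ℂ‖ ^ 2 : ℝ) : ℂ) := by
    have h1 : ⟪onA G ξ, onA (projAll PA w) (onA G ξ)⟫_ℂ =
        ⟪onA (projAll PA w) (onA G ξ), onA (projAll PA w) (onA G ξ)⟫_ℂ := by
      have hs : star (onA (projAll PA w) : Op ((∀ i, α i) × (∀ i, β i))) = onA (projAll PA w) :=
        hproj.isSelfAdjoint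
      have hi : onA (projAll PA w) (onA (projAll PA w) (onA G ξ)) =
          onA (projAll PA w) (onA G ξ) := DFunLike.congr_fun hproj.isIdempotentElem (onA G ξ)
      conv_rhs => rw [← ContinuousLinearMap.adjoint_inner_right,
        ← ContinuousLinearMap.star_eq_adjoint, hs, hi]
    rw [h1, inner_self_eq_norm_sq_to_K, hout, norm_smul,
      hK.norm_prodOn_ketOp Finset.univ w hu fun i _ => hg i, hinner, norm_mul, Complex.norm_real,
      Real.norm_of_nonneg (Real.sqrt_nonneg _)]
    exact (Complex.ofReal_pow _ 2).symm.trans (congrArg Complex.ofReal (hreal _))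
  rw [hρ, ← hval]
  exact hasTrace_mul_reducedState _ _

theorem applyMat_single (T : Matrix (Fin n → Fin 2) (Fin n → Fin 2) ℂ) (x y : Fin n → Fin 2)
    [DecidableEq (Fin n → Fin 2)] :
    applyMat T (EuclideanSpace.single x 1) y = T y x := by
  simp [applyMat]

theorem lowerOn_isGround {Ψ : L2 ((∀ i, α i) × (∀ i, β i))}
    (hΨ : ∀ i, IsEPR (regA β PA i) (regB α PB i) Ψ) (x : Fin n → Fin 2) :
    lowerOn (regA β PA) Finset.univ x Ψ ∈ orbit (rightOps _ _) Ψ ∧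
      ∀ i, IsGround (regA β PA i) (lowerOn (regA β PA) Finset.univ x Ψ) :=
  have h := (isBipartite PA PB).isRegister hΨ
  ⟨h.lowerOn_mem _ x (self_mem_orbit _ Ψ), fun i =>
    h.isGround_lowerOn x (self_mem_orbit _ Ψ) (Finset.mem_univ i)⟩

theorem inputState_simulates {Ψ : L2 ((∀ i, α i) × (∀ i, β i))} (hnorm : ‖Ψ‖ = 1)
    (hΨ : ∀ i, IsEPR (regA β PA i) (regB α PB i) Ψ) (x : Fin n → Fin 2)
    [DecidableEq (Fin n → Fin 2)] :
    MixedSimulates (projAll PA) kets (inputState PB Ψ x) (EuclideanSpace.single x 1) := by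
  obtain ⟨hu, hg⟩ := lowerOn_isGround hΨ x
  have := mixedSimulates_of_action hnorm hΨ x 1 1 ((isBipartite PA PB).isRegister hΨ) hu hg rfl
    (by simp [onA, amp_one, Matrix.one_apply]) (EuclideanSpace.single x 1)
    (fun y => by simp [Matrix.one_apply])
  simpa using this

theorem circuit_simulates {t : ℕ} (g : Fin t → Gate α β) {Ψ : L2 ((∀ i, α i) × (∀ i, β i))}
    (hnorm : ‖Ψ‖ = 1) (h : SimulationConditions PA PB g Ψ) (x : Fin n → Fin 2) :
    MixedSimulates (projAll PA) kets
      ((compose fun j => (g j).extA) * inputState PB Ψ x * star (compose fun j => (g j).extA))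
      (applyMat (compose fun j => (g j).extIdeal) (EuclideanSpace.single x 1)) := by
  have hΨ : ∀ i, IsEPR (regA β PA i) (regB α PB i) Ψ := fun i =>
    (isEPR_iff PA PB i Ψ).2 (h.source i)
  obtain ⟨hu, hg⟩ := lowerOn_isGround hΨ x
  obtain ⟨K, hK, u', hu', hg', hn, hact⟩ := circuit_action g Ψ h hu hg
  exact mixedSimulates_of_action hnorm hΨ x _ _ hK hu' hg' hn (hact x) _ fun y => by
    rw [applyMat_single]

/-! ### The finite list of statistics and its length -/

theorem simulationConditions_iff {t : ℕ} (g : Fin t → Gate α β)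
    (Ψ : L2 ((∀ i, α i) × (∀ i, β i))) :
    SimulationConditions PA PB g Ψ ↔
      ∀ s : Statistic (fun j => (g j).support), observed PA PB g Ψ s = expected g s := by
  constructor
  · rintro h (⟨i, ab⟩ | ⟨j, i, ab⟩ | ⟨j, ab⟩)
    · exact h.source i ab
    · exact h.conspiracy j i i.2 ab
    · exact h.tomography j ab
  · intro h
    exact ⟨fun i ab => h (.inl (i, ab)), fun j i hi ab => h (.inr (.inl ⟨j, ⟨i, hi⟩, ab⟩)),
      fun j ab => h (.inr (.inr ⟨j, ab⟩))⟩

/-- Two of six angles give 36 outcomes per tested pair, and two tuples of angles on a gate give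
6^|I| · 6^|I| = 36^|I| ≤ 36^k. -/
theorem card_statistic_le {t k : ℕ} (I : Fin t → Finset (Fin n)) (hI : ∀ j, (I j).card ≤ k) :
    Fintype.card (Statistic I) ≤ 36 * n + (36 * k + 36 ^ k) * t := by
  have h1 : Fintype.card (Statistic I) =
      n * 36 + ((∑ j, (I j).card * 36) + ∑ j, 6 ^ (I j).card * 6 ^ (I j).card) := by
    simp [Statistic, Angle, Fintype.card_sum, Fintype.card_sigma]
  have h2 : ∑ j, (I j).card * 36 ≤ ∑ _j : Fin t, k * 36 :=
    Finset.sum_le_sum fun j _ => Nat.mul_le_mul_right _ (hI j)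
  have h3 : ∑ j, 6 ^ (I j).card * 6 ^ (I j).card ≤ ∑ _j : Fin t, 36 ^ k :=
    Finset.sum_le_sum fun j _ => by
      rw [← mul_pow]
      exact Nat.pow_le_pow_right (by norm_num) (hI j)
  simp only [Finset.sum_const, Finset.card_univ, Fintype.card_fin, smul_eq_mul] at h2 h3
  rw [h1]
  linarith

theorem card_le_of_covered {t k : ℕ} (I : Fin t → Finset (Fin n)) (hI : ∀ j, (I j).card ≤ k)
    (hcov : ∀ i, ∃ j, i ∈ I j) : n ≤ k * t := by
  have h : (Finset.univ : Finset (Fin n)) ⊆ Finset.univ.biUnion I := fun i _ => by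
    obtain ⟨j, hj⟩ := hcov i
    exact Finset.mem_biUnion.2 ⟨j, Finset.mem_univ j, hj⟩
  calc n = (Finset.univ : Finset (Fin n)).card := by simp
    _ ≤ (Finset.univ.biUnion I).card := Finset.card_le_card h
    _ ≤ ∑ j, (I j).card := Finset.card_biUnion_le
    _ ≤ ∑ _j : Fin t, k := Finset.sum_le_sum fun j _ => hI j
    _ = k * t := by simp [mul_comm]

end Circuit

end SelfTest

end

theorem mainTheorem7 (k : ℕ) :
    ∃ C : ℕ, ∀ (n t : ℕ) (α : Fin n → Type*) (β : Fin n → Type*)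
      (PA : ∀ i, SelfTest.Measurements (α i)) (PB : ∀ i, SelfTest.Measurements (β i))
      (g : Fin t → SelfTest.Gate α β) (_ : ∀ j, (g j).support.card ≤ k)
      (GA : unitary (SelfTest.Op (∀ i, α i)))
      (T : Matrix.unitaryGroup (Fin n → Fin 2) ℂ)
      (_ : (GA : SelfTest.Op (∀ i, α i)) = SelfTest.compose fun j => (g j).extA)
      (_ : (T : Matrix (Fin n → Fin 2) (Fin n → Fin 2) ℂ) =
        SelfTest.compose fun j => (g j).extIdeal)
      (Ψ : SelfTest.L2 ((∀ i, α i) × (∀ i, β i))) (_ : ‖Ψ‖ = 1),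
      -- under the simulation conditions, the input states and the circuit are simulated
      (SelfTest.SimulationConditions PA PB g Ψ →
        (∀ x : Fin n → Fin 2,
          SelfTest.MixedSimulates (SelfTest.projAll PA) SelfTest.kets
            (SelfTest.inputState PB Ψ x) (EuclideanSpace.single x 1)) ∧
        SelfTest.GateSimulates (SelfTest.projAll PA) SelfTest.kets
          (SelfTest.inputState PB Ψ) (GA : SelfTest.Op (∀ i, α i))
          (T : Matrix (Fin n → Fin 2) (Fin n → Fin 2) ℂ)) ∧
      -- the conditions amount to checking a finite list of statistics
      (SelfTest.SimulationConditions PA PB g Ψ ↔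
        ∀ s : SelfTest.Statistic (fun j => (g j).support),
          SelfTest.observed PA PB g Ψ s = SelfTest.expected g s) ∧
      -- whose length is `O(n + t)`, and `O(t)` if every qubit is acted on by some gate
      Fintype.card (SelfTest.Statistic (fun j => (g j).support)) ≤ C * (n + t) ∧
      ((∀ i, ∃ j, i ∈ (g j).support) →
        Fintype.card (SelfTest.Statistic (fun j => (g j).support)) ≤ C * t) := by
  -- The count is at most 36 n + (36 k + 36^k) t. When the gates cover all qubits, n ≤ k t adds
  -- another 36 k t, whence 72 k.
  refine ⟨36 + 72 * k + 36 ^ k, fun n t α β PA PB g hg GA T hGA hT Ψ hΨ =>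
    ⟨fun h => ?_, SelfTest.simulationConditions_iff g Ψ, ?_, fun hcov => ?_⟩⟩
  · have hin := fun x => SelfTest.inputState_simulates hΨ
      (fun i => (SelfTest.isEPR_iff PA PB i Ψ).2 (h.source i)) x
    refine ⟨fun x => hin x, fun x => ?_, fun x => ?_⟩
    · convert hin x
    · have := SelfTest.circuit_simulates g hΨ h x
      rw [← hGA, ← hT] at this
      convert this
  · have := SelfTest.card_statistic_le _ hg
    nlinarith [Nat.zero_le (72 * k * n), Nat.zero_le (36 ^ k * n), Nat.zero_le (36 * k * t)]
  · have h1 := SelfTest.card_statistic_le _ hg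
    have h2 := SelfTest.card_le_of_covered _ hg hcov
    nlinarith
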